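/- **Setting.** Let $k\ge 2$, $X\in\mathbb R^{n\times p}$, $Y=[y_1,\dots,y_k]\in\mathbb R^{n\times k}$. For a width $q$, a shared layer $W\in\mathbb R^{p\times q}$ and heads $A=[a_1,\dots,a_k]\in\mathbb R^{q\times k}$, task $i$ has loss $L_i(W,A)=\|XWa_i-y_i\|^2$. A pair $(W,A)$ is a Pareto optimum if no other pair is at least as good on all tasks and strictly better on some task; the loss vectors $(L_1,\dots,L_k)$ of the Pareto optima form the Pareto front. Such a loss vector is reached by scalarization if it is the loss vector of a global minimizer of $\sum_i\lambda_iL_i$ for some $\lambda_i\ge 0$ with $\sum_i\lambda_i=1$; scalarization fully explores the Pareto front if every point of it is reached. Let $\hat y_i=X(X^\top X)^\dagger X^\top y_i$, assume that $\hat y_1,\dots,\hat y_k$ are linearly independent, and put $\hat Y=[\hat y_1,\dots,\hat y_k]$, $G=\hat Y^\top\hat Y$, $Q=G^{-1}$, $t=(\|\hat y_1\|^2,\dots,\|\hat y_k\|^2)$. Let $$\mathcal F_q=\{(\hat y_i^\top P\hat y_i)_{i}: P \text{ an orthogonal projection matrix of rank } q \text{ with range in } \operatorname{span}\{\hat y_i\}\}$$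 and let $\mathrm{PF}_q$ be the set of componentwise maximal points of $\mathcal F_q$; a point $v\in\mathcal F_q$ stands for the loss vector $(\|y_i\|^2-v_i)_i$. For $T\subseteq\{1,\dots,k\}$ let $D_T$ be the diagonal matrix with entries $-1$ at the positions in $T$ and $1$ elsewhere, $Q_T=D_TQD_T$, $G_T=Q_T^{-1}$, and (with entrywise square roots) $$E_T=\{v\ge 0:\sqrt v^{\top}Q_T\sqrt v=1\},\qquad I_T=\{v\le t:\sqrt{t-v}^{\top}Q_T\sqrt{t-v}=1\}.$$ A matrix is doubly non-negative if it is symmetric positive semi-definite with non-negative entries. C1: some $G_T$ is doubly non-negative. C2: some $Q_T$ is doubly non-negative. An intersection point of $\mathrm{PF}_q$ is a $P\in\mathrm{PF}_q$ that lies on two different surfaces $S_T\ne S_{T'}$, where $S_T=E_T$ if $q=1$ is considered with C1, and $S_T=I_T$ if $q=k-1$ is considered with C2. It is called a relative interior point if all points of $S_T\cap S_{T'}$ close enough to $P$ belong to $\mathrm{PF}_q$. **Theorem.** Let $q=1$ (resp. $q=k-1$). Assume that (a) $\mathrm{PF}_q$ is path-connected, and (b) if $\mathrm{PF}_q$ has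 an intersection point, then it has one that is a relative interior point. Then C1 (resp. C2) is necessary for scalarization to fully explore the Pareto front. Moreover, if C1 (resp. C2) fails, there is an intersection point $v\in\mathrm{PF}_q$ of two different surfaces $S_T,S_{T'}$ at which the functions $\sqrt v^{\top}Q_{T}\sqrt v$ and $\sqrt v^{\top}Q_{T'}\sqrt v$ (resp. $\sqrt{t-v}^{\top}Q_T\sqrt{t-v}$ and $\sqrt{t-v}^{\top}Q_{T'}\sqrt{t-v}$) are differentiable with gradients in different directions, and the point $(\|y_i\|^2-v_i)_i$ of the Pareto front is not reached by scalarization. If $k=3$, all these conclusions hold for $q=1$ (with C1) and $q=2$ (with C2) without assumptions (a) and (b). -/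

import Mathlib

open Topology

noncomputable section

namespace LinearMTL

/-! ### The linear multi-task problem -/

section Problem

variable {n p k : ℕ}

/-- Training loss of task `i` for the two-layer linear network with shared layer `W` and heads
`a_i` (the columns of `A`): `L_i(W, a_i) = ‖X W a_i - y_i‖²`. -/
def loss {q : ℕ} (X : Matrix (Fin n) (Fin p) ℝ) (Y : Matrix (Fin n) (Fin k) ℝ)
    (W : Matrix (Fin p) (Fin q) ℝ) (A : Matrix (Fin q) (Fin k) ℝ) (i : Fin k) : ℝ :=
  ∑ j, ((X * W * A) j i - Y j i) ^ 2

/-- `(W, A)` is a Pareto optimum of the width-`q` problem: no `(W', A')` is at least as good on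
every task and strictly better on some task. -/
def IsParetoOptimum {q : ℕ} (X : Matrix (Fin n) (Fin p) ℝ) (Y : Matrix (Fin n) (Fin k) ℝ)
    (W : Matrix (Fin p) (Fin q) ℝ) (A : Matrix (Fin q) (Fin k) ℝ) : Prop :=
  ¬ ∃ (W' : Matrix (Fin p) (Fin q) ℝ) (A' : Matrix (Fin q) (Fin k) ℝ),
    (∀ i, loss X Y W' A' i ≤ loss X Y W A i) ∧ ∃ i, loss X Y W' A' i < loss X Y W A i

/-- The Pareto front of the width-`q` problem, as a set of loss vectors. -/
def lossFront (X : Matrix (Fin n) (Fin p) ℝ) (Y : Matrix (Fin n) (Fin k) ℝ) (q : ℕ) :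
    Set (Fin k → ℝ) :=
  {z | ∃ (W : Matrix (Fin p) (Fin q) ℝ) (A : Matrix (Fin q) (Fin k) ℝ),
    IsParetoOptimum X Y W A ∧ loss X Y W A = z}

/-- The loss vector `z` is reached by linear scalarization: for some convex coefficients
(`c i ≥ 0`, `∑ c i = 1`) some global minimizer of `∑ c i * L_i` has loss vector `z`. -/
def ReachedByScalarization (X : Matrix (Fin n) (Fin p) ℝ) (Y : Matrix (Fin n) (Fin k) ℝ) (q : ℕ)
    (z : Fin k → ℝ) : Prop :=
  ∃ c ∈ stdSimplex ℝ (Fin k), ∃ (W : Matrix (Fin p) (Fin q) ℝ) (A : Matrix (Fin q) (Fin k) ℝ),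
    (∀ (W' : Matrix (Fin p) (Fin q) ℝ) (A' : Matrix (Fin q) (Fin k) ℝ),
      ∑ i, c i * loss X Y W A i ≤ ∑ i, c i * loss X Y W' A' i) ∧ loss X Y W A = z

/-- Scalarization fully explores the Pareto front. -/
def FullyExplores (X : Matrix (Fin n) (Fin p) ℝ) (Y : Matrix (Fin n) (Fin k) ℝ) (q : ℕ) : Prop :=
  ∀ z ∈ lossFront X Y q, ReachedByScalarization X Y q z

/-- The matrix `Ŷ` whose `i`-th column is `ŷ_i = X (XᵀX)† Xᵀ y_i`, the optimal linear prediction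
for task `i`, that is, the orthogonal projection of `y_i` onto the column space of `X`. -/
def optPred (X : Matrix (Fin n) (Fin p) ℝ) (Y : Matrix (Fin n) (Fin k) ℝ) :
    Matrix (Fin n) (Fin k) ℝ :=
  Matrix.of fun j i =>
    (LinearMap.range (Matrix.toEuclideanLin X)).starProjection
      (WithLp.toLp 2 (fun l => Y l i)) j

end Problem

/-! ### The feasible region and its surfaces

From here on `Yh` is the matrix of optimal predictions. -/

section Region

variable {n k : ℕ}

/-- The feasible region `F_q`: the vectors `(ŷ_iᵀ P ŷ_i)_i` for `P` an orthogonal projection matrix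
of rank `q` with range in the span of the `ŷ_i`. -/
def feasibleRegion (Yh : Matrix (Fin n) (Fin k) ℝ) (q : ℕ) : Set (Fin k → ℝ) :=
  {v | ∃ P : Matrix (Fin n) (Fin n) ℝ, P * P = P ∧ P.IsSymm ∧ P.rank = q ∧
    (∀ w, P.mulVec w ∈ Submodule.span ℝ (Set.range Yh.transpose)) ∧
    ∀ i, v i = dotProduct (Yh.transpose i) (P.mulVec (Yh.transpose i))}

/-- The Pareto front of the reformulated problem (each `ŷ_iᵀ P ŷ_i` is to be maximized), a subset
of the feasible region. -/
def paretoFront (Yh : Matrix (Fin n) (Fin k) ℝ) (q : ℕ) : Set (Fin k → ℝ) :=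
  {v | Maximal (· ∈ feasibleRegion Yh q) v}

/-- `D_{i_1 ⋯ i_l}` with `T = {i_1, …, i_l}`. -/
def signFlip (T : Finset (Fin k)) : Matrix (Fin k) (Fin k) ℝ :=
  Matrix.diagonal fun i => if i ∈ T then -1 else 1

/-- `Q_{i_1 ⋯ i_l} = D Q D` with `Q = G⁻¹` and `G = Ŷᵀ Ŷ`. -/
def Qmat (Yh : Matrix (Fin n) (Fin k) ℝ) (T : Finset (Fin k)) : Matrix (Fin k) (Fin k) ℝ :=
  signFlip T * (Yh.transpose * Yh)⁻¹ * signFlip T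

/-- `G_{i_1 ⋯ i_l} = Q_{i_1 ⋯ i_l}⁻¹`. -/
def Gmat (Yh : Matrix (Fin n) (Fin k) ℝ) (T : Finset (Fin k)) : Matrix (Fin k) (Fin k) ℝ :=
  (Qmat Yh T)⁻¹

/-- A doubly non-negative matrix. -/
def DoublyNonneg (M : Matrix (Fin k) (Fin k) ℝ) : Prop :=
  M.PosSemidef ∧ ∀ i j, 0 ≤ M i j

/-- Condition `C1`: some `G_{i_1 ⋯ i_l}` is doubly non-negative. -/
def C1 (Yh : Matrix (Fin n) (Fin k) ℝ) : Prop := ∃ T, DoublyNonneg (Gmat Yh T)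

/-- Condition `C2`: some `Q_{i_1 ⋯ i_l}` is doubly non-negative. -/
def C2 (Yh : Matrix (Fin n) (Fin k) ℝ) : Prop := ∃ T, DoublyNonneg (Qmat Yh T)

/-- The function `w ↦ √wᵀ Q_T √w`, with entrywise square roots. -/
def sqrtForm (Yh : Matrix (Fin n) (Fin k) ℝ) (T : Finset (Fin k)) (w : Fin k → ℝ) : ℝ :=
  dotProduct (fun i => √(w i)) ((Qmat Yh T).mulVec fun i => √(w i))

/-- The vector `t = (‖ŷ_1‖², …, ‖ŷ_k‖²)`. -/
def sqNorms (Yh : Matrix (Fin n) (Fin k) ℝ) (i : Fin k) : ℝ := ∑ j, Yh j i ^ 2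

/-- The defining function of the surface `E_T`. -/
def formE (Yh : Matrix (Fin n) (Fin k) ℝ) (T : Finset (Fin k)) (v : Fin k → ℝ) : ℝ :=
  sqrtForm Yh T v

/-- The defining function of the surface `I_T`. -/
def formI (Yh : Matrix (Fin n) (Fin k) ℝ) (T : Finset (Fin k)) (v : Fin k → ℝ) : ℝ :=
  sqrtForm Yh T (sqNorms Yh - v)

/-- The surface `E_T = {v : √vᵀ Q_T √v = 1}`; the square root presupposes `v ≥ 0`. -/
def surfE (Yh : Matrix (Fin n) (Fin k) ℝ) (T : Finset (Fin k)) : Set (Fin k → ℝ) :=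
  {v | 0 ≤ v ∧ formE Yh T v = 1}

/-- The surface `I_T = {v : √(t-v)ᵀ Q_T √(t-v) = 1}`; the square root presupposes `v ≤ t`. -/
def surfI (Yh : Matrix (Fin n) (Fin k) ℝ) (T : Finset (Fin k)) : Set (Fin k → ℝ) :=
  {v | v ≤ sqNorms Yh ∧ formI Yh T v = 1}

/-- The gradient of `f` at `v`, as the vector of partial derivatives. -/
def grad (f : (Fin k → ℝ) → ℝ) (v : Fin k → ℝ) : Fin k → ℝ :=
  fun i => fderiv ℝ f v (Pi.single i 1)

/-- Gradient disagreement at `v`: both functions are differentiable there and their gradients point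
in different directions. -/
def GradientsDisagree (f g : (Fin k → ℝ) → ℝ) (v : Fin k → ℝ) : Prop :=
  DifferentiableAt ℝ f v ∧ DifferentiableAt ℝ g v ∧ ¬ SameRay ℝ (grad f v) (grad g v)

/-- `P` is a point of `F` lying on the two surfaces `S T` and `S T'`, which are different. -/
def IsIntersectionPoint (F : Set (Fin k → ℝ)) (S : Finset (Fin k) → Set (Fin k → ℝ))
    (T T' : Finset (Fin k)) (P : Fin k → ℝ) : Prop :=
  P ∈ F ∧ S T ≠ S T' ∧ P ∈ S T ∩ S T'

/-- Non-degeneracy of a front `F` with respect to a family of surfaces: if `F` has intersection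
points at all, then one of them is a relative interior point of `F`, in the sense that all points
of the intersection of the two surfaces that are close enough to it belong to `F`. -/
def NonDegenerate (F : Set (Fin k → ℝ)) (S : Finset (Fin k) → Set (Fin k → ℝ)) : Prop :=
  (∃ T T' P, IsIntersectionPoint F S T T' P) →
    ∃ T T' P, IsIntersectionPoint F S T T' P ∧ ∀ᶠ v in 𝓝[S T ∩ S T'] P, v ∈ F

end Region

section Main

variable {n p k : ℕ}

/-- Condition `C` is necessary for scalarization to fully explore the Pareto front of width `q`,
and, if `C` fails, this is witnessed by a Pareto optimum `v` on two surfaces `{φ T = 1}`,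
`{φ T' = 1}` (as sets, `S T` and `S T'`) with gradient disagreement. The loss vector that
corresponds to a point `v` of the feasible region is `(‖y_i‖² - v_i)_i`. -/
def NecessaryForExploration (X : Matrix (Fin n) (Fin p) ℝ) (Y : Matrix (Fin n) (Fin k) ℝ) (q : ℕ)
    (S : Finset (Fin k) → Set (Fin k → ℝ)) (φ : Finset (Fin k) → (Fin k → ℝ) → ℝ)
    (C : Prop) : Prop :=
  (FullyExplores X Y q → C) ∧
  (¬ C → ∃ T T' v, IsIntersectionPoint (paretoFront (optPred X Y) q) S T T' v ∧
    GradientsDisagree (φ T) (φ T') v ∧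
    sqNorms Y - v ∈ lossFront X Y q ∧
    ¬ ReachedByScalarization X Y q (sqNorms Y - v))

end Main

end LinearMTL

end

/-! The problem lives on the ellipsoid `quad Q u = 1` with `Q = G⁻¹`. A rank-one projection onto the
line of a unit vector `s = Ŷ a` yields `v = u ^ 2` with `u = G a`, and `quad Q u = ‖s‖² = 1`; taking
complements inside the span of the `ŷ_i` turns width `1` into width `k - 1` through `v ↦ t - v`.
Writing `u` as `|u|` with signs splits the feasible region into the surfaces `E_T` (or `I_T`).
Losses are compared with feasible points by `exists_loss_eq` and `exists_feasible_ge_loss`.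

Why a tie is not reached: a scalarization optimum maximizes a linear function of `u ^ 2` on the
ellipsoid. If `x > 0` lies on the level sets of `Q_T` and `Q_{T'}`, the multiplier rule
`IsPD.lagrange_flip` makes `Q_T x` and `Q_{T'} x` the same multiple of `c * x`. The gradient at `x ^
2` has entries `(Q_T x)_i / x_i` up to sign, so gradient disagreement excludes every weight. It
remains to find a Pareto optimal positive `x` with such a tie whenever the condition fails.

Width `k - 1`: domination means `|u| ≤ x`, and a positive definite form on a box is maximal only at
vertices, so `x` is optimal as soon as its sign pattern maximizes the form. If maximal patterns
could tie only with equal gradients, a pattern maximal on an open set would stay maximal along every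
segment (`maximal_of_segment`), hence on the whole orthant, and testing it at `e_i + e_j` gives C2.

Width `1`: the front contains the point maximizing each coordinate, given by a column of `G`. If the
connected front met no two surfaces at once it would lie in one `E_T`, and these columns would then
have the signs of `T` up to a global sign, which is C1 (`C1_of_paretoFront_subset`). So there is an
intersection point; a relative interior one can be perturbed inside the intersection until its
coordinates are positive and the gradients differ (`exists_positive_of_relInterior`).

Three tasks, width `1`: failure of C1 allows signs with all off-diagonal entries of `G` negative,
and `exists_positive_three` exhibits an explicit optimal tie. -/

namespace LinearMTL

/-! ### Quadratic forms and sign flips -/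

section Quad

open Matrix

variable {k : ℕ}

/-- The value of the quadratic form of `Q` at `u`. -/
def quad (Q : Matrix (Fin k) (Fin k) ℝ) (u : Fin k → ℝ) : ℝ := u ⬝ᵥ Q *ᵥ u

/-- The signs of the coordinates after flipping those in `T`. -/
def sgn (T : Finset (Fin k)) (i : Fin k) : ℝ := if i ∈ T then -1 else 1

/-- The matrix `D_T Q D_T`. -/
def flip (Q : Matrix (Fin k) (Fin k) ℝ) (T : Finset (Fin k)) : Matrix (Fin k) (Fin k) ℝ :=
  signFlip T * Q * signFlip T

/-- Symmetric matrices with positive quadratic form. -/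
structure IsPD (Q : Matrix (Fin k) (Fin k) ℝ) : Prop where
  symm : Q.IsSymm
  pos : ∀ u, u ≠ 0 → 0 < quad Q u

theorem sgn_mul_self (T : Finset (Fin k)) (i : Fin k) : sgn T i * sgn T i = 1 := by
  unfold sgn; split_ifs <;> norm_num

theorem sgn_sq (T : Finset (Fin k)) (i : Fin k) : sgn T i ^ 2 = 1 := by
  rw [sq, sgn_mul_self]

theorem sgn_mul_sgn_mul (T : Finset (Fin k)) (u : Fin k → ℝ) : sgn T * (sgn T * u) = u := by
  ext i
  simp only [Pi.mul_apply]
  rw [← mul_assoc, sgn_mul_self, one_mul]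

theorem sgn_mul_ne_zero (T : Finset (Fin k)) {u : Fin k → ℝ} (hu : u ≠ 0) : sgn T * u ≠ 0 := by
  intro h
  apply hu
  rw [← sgn_mul_sgn_mul T u, h, mul_zero]

theorem sgn_mul_sq (T : Finset (Fin k)) (u : Fin k → ℝ) (i : Fin k) :
    (sgn T * u) i ^ 2 = u i ^ 2 := by
  simp [mul_pow, sgn_sq]

/-- Every vector is the vector of its absolute values with some signs flipped. -/
theorem exists_eq_sgn_mul_abs (u : Fin k → ℝ) :
    ∃ T : Finset (Fin k), u = sgn T * fun i => |u i| := by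
  classical
  refine ⟨Finset.univ.filter fun i => u i < 0, ?_⟩
  ext i
  by_cases h : u i < 0
  · simp [sgn, h, abs_of_neg h]
  · simp [sgn, h, abs_of_nonneg (not_lt.mp h)]

theorem flip_apply (Q : Matrix (Fin k) (Fin k) ℝ) (T : Finset (Fin k)) (i j : Fin k) :
    flip Q T i j = sgn T i * Q i j * sgn T j := by
  simp only [flip, signFlip, Matrix.mul_diagonal, Matrix.diagonal_mul, sgn]

theorem flip_mulVec (Q : Matrix (Fin k) (Fin k) ℝ) (T : Finset (Fin k)) (x : Fin k → ℝ) :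
    flip Q T *ᵥ x = sgn T * (Q *ᵥ (sgn T * x)) := by
  ext i
  simp only [Matrix.mulVec, dotProduct, Pi.mul_apply, flip_apply, Finset.mul_sum]
  exact Finset.sum_congr rfl fun j _ => by ring

theorem quad_flip (Q : Matrix (Fin k) (Fin k) ℝ) (T : Finset (Fin k)) (x : Fin k → ℝ) :
    quad (flip Q T) x = quad Q (sgn T * x) := by
  simp only [quad, flip_mulVec, dotProduct, Pi.mul_apply]
  exact Finset.sum_congr rfl fun j _ => by ring

theorem flip_diag (Q : Matrix (Fin k) (Fin k) ℝ) (T : Finset (Fin k)) (i : Fin k) :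
    flip Q T i i = Q i i := by
  rw [flip_apply, mul_right_comm, sgn_mul_self, one_mul]

theorem signFlip_mul_self (T : Finset (Fin k)) : signFlip T * signFlip T = 1 := by
  simp only [signFlip, Matrix.diagonal_mul_diagonal]
  rw [← Matrix.diagonal_one]
  congr 1
  ext i
  exact sgn_mul_self T i

theorem flip_inv (Q : Matrix (Fin k) (Fin k) ℝ) (T : Finset (Fin k)) :
    (flip Q T)⁻¹ = flip Q⁻¹ T := by
  have h : (signFlip T)⁻¹ = signFlip T := Matrix.inv_eq_right_inv (signFlip_mul_self T)
  simp only [flip, Matrix.mul_inv_rev, h, Matrix.mul_assoc]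

theorem dotProduct_mulVec_symm {Q : Matrix (Fin k) (Fin k) ℝ} (hQ : Q.IsSymm) (u w : Fin k → ℝ) :
    u ⬝ᵥ Q *ᵥ w = w ⬝ᵥ Q *ᵥ u := by
  rw [Matrix.dotProduct_mulVec, ← Matrix.mulVec_transpose, hQ.eq, dotProduct_comm]

theorem quad_add {Q : Matrix (Fin k) (Fin k) ℝ} (hQ : Q.IsSymm) (u w : Fin k → ℝ) :
    quad Q (u + w) = quad Q u + 2 * (w ⬝ᵥ Q *ᵥ u) + quad Q w := by
  simp only [quad, Matrix.mulVec_add, dotProduct_add, add_dotProduct]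
  rw [dotProduct_mulVec_symm hQ u w]
  ring

theorem quad_smul (Q : Matrix (Fin k) (Fin k) ℝ) (c : ℝ) (u : Fin k → ℝ) :
    quad Q (c • u) = c ^ 2 * quad Q u := by
  simp only [quad, Matrix.mulVec_smul, dotProduct_smul, smul_dotProduct, smul_eq_mul]
  ring

theorem quad_single (Q : Matrix (Fin k) (Fin k) ℝ) (i : Fin k) (c : ℝ) :
    quad Q (Pi.single i c) = c ^ 2 * Q i i := by
  simp only [quad, single_dotProduct, Matrix.mulVec_single, Pi.smul_apply, Matrix.col_apply]
  simp
  ring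

theorem quad_add_single {Q : Matrix (Fin k) (Fin k) ℝ} (hQ : Q.IsSymm) (u : Fin k → ℝ)
    (i : Fin k) (c : ℝ) :
    quad Q (u + Pi.single i c) = quad Q u + 2 * c * (Q *ᵥ u) i + c ^ 2 * Q i i := by
  rw [quad_add hQ, quad_single, single_dotProduct]
  ring

theorem quad_single_add_single {Q : Matrix (Fin k) (Fin k) ℝ} (hQ : Q.IsSymm) (i j : Fin k) :
    quad Q (Pi.single i 1 + Pi.single j 1) = Q i i + 2 * Q i j + Q j j := by
  rw [quad_add_single hQ, quad_single, Matrix.mulVec_single_one, Matrix.col_apply]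
  linarith [hQ.apply i j]

theorem continuous_quad (Q : Matrix (Fin k) (Fin k) ℝ) : Continuous (quad Q) := by
  unfold quad
  simp only [Matrix.mulVec, dotProduct]
  fun_prop

theorem continuous_mulVec_apply (Q : Matrix (Fin k) (Fin k) ℝ) (i : Fin k) :
    Continuous fun u => (Q *ᵥ u) i := by
  simp only [Matrix.mulVec, dotProduct]
  fun_prop

/-- A quadratic form that vanishes at `u` and is nonnegative has `u` in its kernel. -/
theorem mulVec_eq_zero_of_quad_nonneg {Q : Matrix (Fin k) (Fin k) ℝ} (hQ : Q.IsSymm)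
    (h0 : ∀ w, 0 ≤ quad Q w) {u : Fin k → ℝ} (hu : quad Q u = 0) : Q *ᵥ u = 0 := by
  ext i
  by_contra hne
  have hne' : (Q *ᵥ u) i ≠ 0 := hne
  have key : ∀ c : ℝ, 0 ≤ 2 * c * (Q *ᵥ u) i + c ^ 2 * Q i i := fun c => by
    have := h0 (u + Pi.single i c)
    rw [quad_add_single hQ, hu] at this
    linarith
  set b := (Q *ᵥ u) i
  have hd : 0 ≤ Q i i := by
    have := h0 (Pi.single i 1)
    rw [quad_single] at this
    linarith
  -- The minimizing step would be `-b / Q i i`; the added `1` covers a zero diagonal entry and still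
  -- makes the value negative.
  have h1 := key (-b / (Q i i + 1))
  have hb : 0 < b ^ 2 := by positivity
  have hd' : 0 < Q i i + 1 := by linarith
  have : 2 * (-b / (Q i i + 1)) * b + (-b / (Q i i + 1)) ^ 2 * Q i i
      = -(b ^ 2 * (Q i i + 2)) / (Q i i + 1) ^ 2 := by
    field_simp
    ring
  rw [this] at h1
  have h2 : 0 < b ^ 2 * (Q i i + 2) / (Q i i + 1) ^ 2 := by positivity
  rw [neg_div] at h1
  linarith

/-- Polarization needs only the vectors `e_i` and `e_i + e_j`, which lie in the nonnegative orthant.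
-/
theorem eq_of_quad_eq_on_nonneg {M N : Matrix (Fin k) (Fin k) ℝ} (hM : M.IsSymm) (hN : N.IsSymm)
    (h : ∀ x, 0 ≤ x → quad M x = quad N x) : M = N := by
  have hs : ∀ i : Fin k, (0 : Fin k → ℝ) ≤ Pi.single i 1 := fun i =>
    Pi.single_nonneg.2 zero_le_one
  have hd : ∀ i, M i i = N i i := fun i => by
    have := h _ (hs i)
    simpa [quad_single] using this
  ext i j
  have := h _ (add_nonneg (hs i) (hs j))
  rw [quad_single_add_single hM, quad_single_add_single hN, hd, hd] at this
  linarith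

namespace IsPD

variable {Q : Matrix (Fin k) (Fin k) ℝ}

theorem nonneg (hQ : IsPD Q) (u : Fin k → ℝ) : 0 ≤ quad Q u := by
  by_cases h : u = 0
  · simp [h, quad]
  · exact (hQ.pos u h).le

theorem diag_pos (hQ : IsPD Q) (i : Fin k) : 0 < Q i i := by
  have := hQ.pos (Pi.single i 1) (by simp)
  rw [quad_single] at this
  linarith

theorem flip (hQ : IsPD Q) (T : Finset (Fin k)) : IsPD (flip Q T) where
  symm := by
    ext i j
    rw [Matrix.transpose_apply, flip_apply, flip_apply, hQ.symm.apply]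
    ring
  pos u hu := by
    rw [quad_flip]
    exact hQ.pos _ (sgn_mul_ne_zero T hu)

theorem posSemidef (hQ : IsPD Q) : Q.PosSemidef := by
  refine Matrix.PosSemidef.of_dotProduct_mulVec_nonneg ?_ fun x => ?_
  · rw [Matrix.IsHermitian, Matrix.conjTranspose_eq_transpose_of_trivial]
    exact hQ.symm
  · simpa [quad] using hQ.nonneg x

theorem eq_zero_of_quad_nonpos (hQ : IsPD Q) {u : Fin k → ℝ} (h : quad Q u ≤ 0) : u = 0 := by
  by_contra hu
  exact absurd (hQ.pos u hu) (not_lt.mpr h)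

/-- Rescaling a nonzero vector to the unit level set. -/
theorem quad_normalize (hQ : IsPD Q) {u : Fin k → ℝ} (hu : u ≠ 0) :
    quad Q ((√(quad Q u))⁻¹ • u) = 1 := by
  have h := hQ.pos u hu
  rw [quad_smul, inv_pow, Real.sq_sqrt h.le, inv_mul_cancel₀ h.ne']

end IsPD

end Quad

/-! ### Projections and the feasible region -/

section Projections

open Matrix

variable {n k q : ℕ}

theorem IsPD.isUnit_det {Q : Matrix (Fin k) (Fin k) ℝ} (hQ : IsPD Q) : IsUnit Q.det := by
  rw [← Matrix.isUnit_iff_isUnit_det, ← Matrix.mulVec_injective_iff_isUnit]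
  intro u w h
  rw [← sub_eq_zero]
  apply hQ.eq_zero_of_quad_nonpos
  have h' : Q *ᵥ u = Q *ᵥ w := h
  rw [quad, Matrix.mulVec_sub, h', sub_self, dotProduct_zero]

theorem IsPD.mulVec_inv_mulVec {Q : Matrix (Fin k) (Fin k) ℝ} (hQ : IsPD Q) (u : Fin k → ℝ) :
    Q *ᵥ (Q⁻¹ *ᵥ u) = u := by
  rw [Matrix.mulVec_mulVec, Matrix.mul_nonsing_inv _ hQ.isUnit_det, Matrix.one_mulVec]

theorem IsPD.inv_mulVec_mulVec {Q : Matrix (Fin k) (Fin k) ℝ} (hQ : IsPD Q) (u : Fin k → ℝ) :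
    Q⁻¹ *ᵥ (Q *ᵥ u) = u := by
  rw [Matrix.mulVec_mulVec, Matrix.nonsing_inv_mul _ hQ.isUnit_det, Matrix.one_mulVec]

theorem IsPD.quad_inv_mulVec {Q : Matrix (Fin k) (Fin k) ℝ} (hQ : IsPD Q) (u : Fin k → ℝ) :
    quad Q⁻¹ (Q *ᵥ u) = quad Q u := by
  rw [quad, hQ.inv_mulVec_mulVec, dotProduct_comm, quad]

theorem IsPD.inv {Q : Matrix (Fin k) (Fin k) ℝ} (hQ : IsPD Q) : IsPD Q⁻¹ where
  symm := by rw [Matrix.IsSymm, Matrix.transpose_nonsing_inv, hQ.symm.eq]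
  pos u hu := by
    rw [← hQ.mulVec_inv_mulVec u, hQ.quad_inv_mulVec]
    apply hQ.pos
    intro h
    apply hu
    rw [← hQ.mulVec_inv_mulVec u, h, Matrix.mulVec_zero]

theorem mulVec_injective_of_linearIndependent {B : Matrix (Fin n) (Fin q) ℝ}
    (hB : LinearIndependent ℝ B.transpose) : Function.Injective B.mulVec :=
  Matrix.mulVec_injective_iff.2 hB

theorem quad_gram (B : Matrix (Fin n) (Fin q) ℝ) (u : Fin q → ℝ) :
    quad (Bᵀ * B) u = (B *ᵥ u) ⬝ᵥ (B *ᵥ u) := by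
  rw [quad, ← Matrix.mulVec_mulVec, Matrix.dotProduct_mulVec, Matrix.vecMul_transpose]

theorem isPD_gram {B : Matrix (Fin n) (Fin q) ℝ} (hB : Function.Injective B.mulVec) :
    IsPD (Bᵀ * B) where
  symm := by rw [Matrix.IsSymm, Matrix.transpose_mul, Matrix.transpose_transpose]
  pos u hu := by
    rw [quad_gram]
    have h : B *ᵥ u ≠ 0 := fun h => hu (hB (h.trans (Matrix.mulVec_zero B).symm))
    exact lt_of_le_of_ne (by simpa using dotProduct_star_self_nonneg (B *ᵥ u))
      fun h0 => h (dotProduct_self_eq_zero.1 h0.symm)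

/-- The orthogonal projection matrix onto the column space of `B`. -/
noncomputable def projMat (B : Matrix (Fin n) (Fin q) ℝ) : Matrix (Fin n) (Fin n) ℝ :=
  B * (Bᵀ * B)⁻¹ * Bᵀ

theorem projMat_mul {B : Matrix (Fin n) (Fin q) ℝ} (hB : Function.Injective B.mulVec) :
    projMat B * B = B := by
  rw [projMat, Matrix.mul_assoc, Matrix.mul_assoc,
    Matrix.nonsing_inv_mul _ (isPD_gram hB).isUnit_det, Matrix.mul_one]

theorem projMat_mulVec {B : Matrix (Fin n) (Fin q) ℝ} (hB : Function.Injective B.mulVec)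
    (a : Fin q → ℝ) : projMat B *ᵥ (B *ᵥ a) = B *ᵥ a := by
  rw [Matrix.mulVec_mulVec, projMat_mul hB]

theorem projMat_mul_self {B : Matrix (Fin n) (Fin q) ℝ} (hB : Function.Injective B.mulVec) :
    projMat B * projMat B = projMat B := by
  nth_rewrite 2 [projMat]
  rw [← Matrix.mul_assoc, ← Matrix.mul_assoc, projMat_mul hB, projMat]

theorem projMat_isSymm {B : Matrix (Fin n) (Fin q) ℝ} (hB : Function.Injective B.mulVec) :
    (projMat B).IsSymm := by
  rw [Matrix.IsSymm, projMat, Matrix.transpose_mul, Matrix.transpose_mul,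
    (isPD_gram hB).inv.symm.eq, Matrix.transpose_transpose, Matrix.mul_assoc]

theorem projMat_trace {B : Matrix (Fin n) (Fin q) ℝ} (hB : Function.Injective B.mulVec) :
    (projMat B).trace = q := by
  rw [projMat, Matrix.trace_mul_comm, ← Matrix.mul_assoc,
    Matrix.mul_nonsing_inv _ (isPD_gram hB).isUnit_det, Matrix.trace_one, Fintype.card_fin]

theorem projMat_mulVec_eq (B : Matrix (Fin n) (Fin q) ℝ) (w : Fin n → ℝ) :
    projMat B *ᵥ w = B *ᵥ ((Bᵀ * B)⁻¹ *ᵥ (Bᵀ *ᵥ w)) := by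
  rw [projMat, Matrix.mulVec_mulVec, Matrix.mulVec_mulVec, Matrix.mul_assoc]

theorem trace_eq_rank {P : Matrix (Fin n) (Fin n) ℝ} (hP : P * P = P) : P.trace = P.rank := by
  have h : IsIdempotentElem (Matrix.toLin' P) := by
    rw [IsIdempotentElem, Module.End.mul_eq_comp, ← Matrix.toLin'_mul, hP]
  rw [← Matrix.trace_toLin'_eq, (LinearMap.IsIdempotentElem.isProj_range _ h).trace]
  rfl

theorem mem_span_iff (B : Matrix (Fin n) (Fin q) ℝ) (w : Fin n → ℝ) :
    w ∈ Submodule.span ℝ (Set.range B.transpose) ↔ ∃ a, B *ᵥ a = w := by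
  have h := Matrix.range_mulVecLin B
  have h2 : B.col = B.transpose := rfl
  rw [h2] at h
  rw [← h, LinearMap.mem_range]
  rfl

/-- `P` is an orthogonal projection matrix of rank `q` with range in the span of the columns
of `Yh`. -/
structure IsProjIn (Yh : Matrix (Fin n) (Fin k) ℝ) (q : ℕ) (P : Matrix (Fin n) (Fin n) ℝ) :
    Prop where
  idem : P * P = P
  symm : P.IsSymm
  rank : P.rank = q
  range : ∀ w, ∃ a, Yh *ᵥ a = P *ᵥ w

theorem mem_feasibleRegion_iff (Yh : Matrix (Fin n) (Fin k) ℝ) (q : ℕ) (v : Fin k → ℝ) :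
    v ∈ feasibleRegion Yh q ↔
      ∃ P, IsProjIn Yh q P ∧ ∀ i, v i = Yhᵀ i ⬝ᵥ P *ᵥ Yhᵀ i := by
  constructor
  · rintro ⟨P, h1, h2, h3, h4, h5⟩
    exact ⟨P, ⟨h1, h2, h3, fun w => (mem_span_iff Yh _).1 (h4 w)⟩, h5⟩
  · rintro ⟨P, ⟨h1, h2, h3, h4⟩, h5⟩
    exact ⟨P, h1, h2, h3, fun w => (mem_span_iff Yh _).2 (h4 w), h5⟩

theorem isProjIn_projMat {Yh : Matrix (Fin n) (Fin k) ℝ} (C : Matrix (Fin k) (Fin q) ℝ)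
    (hB : Function.Injective (Yh * C).mulVec) : IsProjIn Yh q (projMat (Yh * C)) where
  idem := projMat_mul_self hB
  symm := projMat_isSymm hB
  rank := by
    have h := trace_eq_rank (projMat_mul_self hB)
    rw [projMat_trace hB] at h
    exact_mod_cast h.symm
  range w := by
    rw [projMat_mulVec_eq, ← Matrix.mulVec_mulVec]
    exact ⟨_, rfl⟩

theorem IsProjIn.projMat_mul {Yh : Matrix (Fin n) (Fin k) ℝ} (hY : Function.Injective Yh.mulVec)
    {P : Matrix (Fin n) (Fin n) ℝ} (hP : IsProjIn Yh q P) : projMat Yh * P = P := by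
  apply Matrix.ext_of_mulVec_single
  intro i
  obtain ⟨a, ha⟩ := hP.range (Pi.single i 1)
  rw [← Matrix.mulVec_mulVec, ← ha, projMat_mulVec hY]

theorem IsProjIn.mul_projMat {Yh : Matrix (Fin n) (Fin k) ℝ} (hY : Function.Injective Yh.mulVec)
    {P : Matrix (Fin n) (Fin n) ℝ} (hP : IsProjIn Yh q P) : P * projMat Yh = P := by
  have h := congrArg Matrix.transpose (hP.projMat_mul hY)
  rwa [Matrix.transpose_mul, hP.symm.eq, (projMat_isSymm hY).eq] at h

/-- The orthogonal complement, within the column space, of a projection. -/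
theorem IsProjIn.compl {Yh : Matrix (Fin n) (Fin k) ℝ} (hY : Function.Injective Yh.mulVec)
    {P : Matrix (Fin n) (Fin n) ℝ} (hP : IsProjIn Yh q P) :
    IsProjIn Yh (k - q) (projMat Yh - P) := by
  have hidem : (projMat Yh - P) * (projMat Yh - P) = projMat Yh - P := by
    rw [Matrix.sub_mul, Matrix.mul_sub, Matrix.mul_sub, projMat_mul_self hY, hP.projMat_mul hY,
      hP.mul_projMat hY, hP.idem, sub_self, sub_zero]
  refine ⟨hidem, (projMat_isSymm hY).sub hP.symm, ?_, fun w => ?_⟩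
  · have h := trace_eq_rank hidem
    rw [Matrix.trace_sub, projMat_trace hY, trace_eq_rank hP.idem, hP.rank] at h
    have : (k : ℝ) = ((projMat Yh - P).rank + q : ℕ) := by push_cast; linarith
    have := Nat.cast_injective (R := ℝ) this
    omega
  · obtain ⟨a, ha⟩ := hP.range w
    rw [Matrix.sub_mulVec, projMat_mulVec_eq, ← ha, ← Matrix.mulVec_sub]
    exact ⟨_, rfl⟩

theorem transpose_apply_eq_mulVec (Yh : Matrix (Fin n) (Fin k) ℝ) (i : Fin k) :
    Yhᵀ i = Yh *ᵥ Pi.single i 1 := by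
  rw [Matrix.mulVec_single_one]
  rfl

theorem sqNorms_eq (Yh : Matrix (Fin n) (Fin k) ℝ) (i : Fin k) :
    sqNorms Yh i = Yhᵀ i ⬝ᵥ Yhᵀ i := by
  simp only [sqNorms, dotProduct, Matrix.transpose_apply]
  exact Finset.sum_congr rfl fun j _ => sq _

theorem sub_mem_feasibleRegion {Yh : Matrix (Fin n) (Fin k) ℝ}
    (hY : Function.Injective Yh.mulVec) {v : Fin k → ℝ} (hv : v ∈ feasibleRegion Yh q) :
    sqNorms Yh - v ∈ feasibleRegion Yh (k - q) := by
  rw [mem_feasibleRegion_iff] at hv ⊢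
  obtain ⟨P, hP, h⟩ := hv
  refine ⟨_, hP.compl hY, fun i => ?_⟩
  rw [Pi.sub_apply, Matrix.sub_mulVec, dotProduct_sub, ← h, sqNorms_eq]
  nth_rewrite 4 [transpose_apply_eq_mulVec]
  rw [projMat_mulVec hY, ← transpose_apply_eq_mulVec]

/-- A rank-one projection is `s sᵀ` for a unit vector `s = Ŷ a`. The coordinates `u = G a = Ŷᵀ s`
turn `‖s‖ = 1` into `quad G⁻¹ u = 1`. -/
theorem mem_feasibleRegion_one {Yh : Matrix (Fin n) (Fin k) ℝ}
    (hY : Function.Injective Yh.mulVec) (v : Fin k → ℝ) :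
    v ∈ feasibleRegion Yh 1 ↔ ∃ u, quad (Yhᵀ * Yh)⁻¹ u = 1 ∧ v = u ^ 2 := by
  have hG := isPD_gram hY
  rw [mem_feasibleRegion_iff]
  constructor
  · rintro ⟨P, hP, hv⟩
    have h1 : Module.finrank ℝ P.mulVecLin.range = 1 := hP.rank
    obtain ⟨⟨s, w0, hw0⟩, hs0, hs⟩ := finrank_eq_one_iff'.1 h1
    have hw0' : P *ᵥ w0 = s := hw0
    have hPs : P *ᵥ s = s := by rw [← hw0', Matrix.mulVec_mulVec, hP.idem]
    have hs0' : s ≠ 0 := fun h => hs0 (Subtype.ext h)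
    have hss : 0 < s ⬝ᵥ s := lt_of_le_of_ne (by simpa using dotProduct_star_self_nonneg s)
      fun h0 => hs0' (dotProduct_self_eq_zero.1 h0.symm)
    obtain ⟨a, ha⟩ := hP.range w0
    rw [hw0'] at ha
    -- The range is the line through `s`, so symmetry determines `P`; `s` is not normalized, hence
    -- the factor `s ⬝ᵥ s`.
    have hPw : ∀ w, (s ⬝ᵥ s) • P *ᵥ w = (s ⬝ᵥ w) • s := fun w => by
      obtain ⟨c, hc⟩ := hs ⟨P *ᵥ w, w, rfl⟩
      have hc' : c • s = P *ᵥ w := congrArg Subtype.val hc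
      have : s ⬝ᵥ w = c * (s ⬝ᵥ s) := by
        conv_lhs => rw [← hPs]
        rw [dotProduct_comm, dotProduct_mulVec_symm hP.symm, ← hc', dotProduct_smul, smul_eq_mul]
      rw [← hc', this, smul_smul, mul_comm]
    have hGa : (Yhᵀ * Yh) *ᵥ a = fun i => Yhᵀ i ⬝ᵥ s := by
      rw [← Matrix.mulVec_mulVec, ha]
      rfl
    refine ⟨(√(s ⬝ᵥ s))⁻¹ • (Yhᵀ * Yh) *ᵥ a, ?_, ?_⟩
    · rw [quad_smul, hG.quad_inv_mulVec, quad_gram, ha, inv_pow, Real.sq_sqrt hss.le,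
        inv_mul_cancel₀ hss.ne']
    · ext i
      have h2 : (s ⬝ᵥ s) * v i = (Yhᵀ i ⬝ᵥ s) ^ 2 := by
        rw [hv, ← smul_eq_mul, ← dotProduct_smul, hPw, dotProduct_smul, dotProduct_comm s,
          smul_eq_mul, sq]
      rw [hGa, Pi.pow_apply, Pi.smul_apply, smul_eq_mul, mul_pow, inv_pow, Real.sq_sqrt hss.le,
        ← h2, inv_mul_cancel_left₀ hss.ne']
  · rintro ⟨u, hu, rfl⟩
    set a := (Yhᵀ * Yh)⁻¹ *ᵥ u with ha
    have hua : (Yhᵀ * Yh) *ᵥ a = u := hG.mulVec_inv_mulVec u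
    set s := Yh *ᵥ a with hs
    have hss : s ⬝ᵥ s = 1 := by
      rw [hs, ← quad_gram, ← hG.quad_inv_mulVec, hua, hu]
    have hus : ∀ i, Yhᵀ i ⬝ᵥ s = u i := fun i => by
      rw [← hua, ← Matrix.mulVec_mulVec]
      rfl
    have hidem : vecMulVec s s * vecMulVec s s = vecMulVec s s := by
      rw [Matrix.vecMulVec_mul_vecMulVec, hss, one_smul]
    refine ⟨vecMulVec s s, ⟨hidem, ?_, ?_, fun w => ?_⟩, fun i => ?_⟩
    · rw [Matrix.IsSymm, Matrix.transpose_vecMulVec]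
    · have h := trace_eq_rank hidem
      rw [Matrix.trace_vecMulVec, hss] at h
      exact_mod_cast h.symm
    · refine ⟨(s ⬝ᵥ w) • a, ?_⟩
      rw [Matrix.mulVec_smul, Matrix.vecMulVec_mulVec]
      ext j
      simp [mul_comm, hs]
    · rw [Matrix.vecMulVec_mulVec, dotProduct_comm s]
      simp [dotProduct_smul, hus, sq]

theorem mem_feasibleRegion_pred {Yh : Matrix (Fin n) (Fin k) ℝ} (hk : 1 ≤ k)
    (hY : Function.Injective Yh.mulVec) (v : Fin k → ℝ) :
    v ∈ feasibleRegion Yh (k - 1) ↔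
      ∃ u, quad (Yhᵀ * Yh)⁻¹ u = 1 ∧ v = sqNorms Yh - u ^ 2 := by
  constructor
  · intro h
    have h' := sub_mem_feasibleRegion hY h
    rw [Nat.sub_sub_self hk, mem_feasibleRegion_one hY] at h'
    obtain ⟨u, hu, h'⟩ := h'
    exact ⟨u, hu, by rw [← h', sub_sub_cancel]⟩
  · rintro ⟨u, hu, rfl⟩
    exact sub_mem_feasibleRegion hY ((mem_feasibleRegion_one hY _).2 ⟨u, hu, rfl⟩)

end Projections

/-! ### Loss vectors and the feasible region -/

section Loss

open Matrix

variable {n p k q : ℕ}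

theorem dotProduct_self_nonneg_real (w : Fin n → ℝ) : 0 ≤ w ⬝ᵥ w := by
  simpa using dotProduct_star_self_nonneg w

theorem exists_optPred_eq_mulVec (X : Matrix (Fin n) (Fin p) ℝ) (Y : Matrix (Fin n) (Fin k) ℝ)
    (i : Fin k) : ∃ z, (optPred X Y)ᵀ i = X *ᵥ z := by
  have h := Submodule.starProjection_apply_mem (LinearMap.range (Matrix.toEuclideanLin X))
    (WithLp.toLp 2 (fun l => Y l i))
  obtain ⟨z, hz⟩ := h
  refine ⟨z.ofLp, ?_⟩
  have h2 := congrArg WithLp.ofLp hz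
  rw [Matrix.ofLp_toLpLin, Matrix.toLin'_apply] at h2
  rw [h2]
  rfl

theorem mulVec_dotProduct_optPred (X : Matrix (Fin n) (Fin p) ℝ) (Y : Matrix (Fin n) (Fin k) ℝ)
    (i : Fin k) (z : Fin p → ℝ) : (X *ᵥ z) ⬝ᵥ (optPred X Y)ᵀ i = (X *ᵥ z) ⬝ᵥ Yᵀ i := by
  have h := Submodule.sub_starProjection_mem_orthogonal
    (K := LinearMap.range (Matrix.toEuclideanLin X)) (WithLp.toLp 2 (fun l => Y l i))
  have h2 := (Submodule.mem_orthogonal _ _).1 h (Matrix.toEuclideanLin X (WithLp.toLp 2 z))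
    ⟨_, rfl⟩
  rw [inner_sub_right, sub_eq_zero] at h2
  simp only [EuclideanSpace.inner_eq_star_dotProduct, star_trivial,
    Matrix.ofLp_toLpLin, Matrix.toLin'_apply] at h2
  rw [dotProduct_comm, dotProduct_comm _ (Yᵀ i)]
  exact h2.symm

theorem loss_eq (X : Matrix (Fin n) (Fin p) ℝ) (Y : Matrix (Fin n) (Fin k) ℝ)
    (W : Matrix (Fin p) (Fin q) ℝ) (A : Matrix (Fin q) (Fin k) ℝ) (i : Fin k) :
    loss X Y W A i = sqNorms Y i - (2 * (((X * W) *ᵥ Aᵀ i) ⬝ᵥ (optPred X Y)ᵀ i) -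
      ((X * W) *ᵥ Aᵀ i) ⬝ᵥ ((X * W) *ᵥ Aᵀ i)) := by
  rw [← Matrix.mulVec_mulVec, mulVec_dotProduct_optPred, sqNorms_eq, Matrix.mulVec_mulVec]
  simp only [loss, dotProduct, Finset.mul_sum, ← Finset.sum_sub_distrib]
  refine Finset.sum_congr rfl fun j _ => ?_
  have : (X * W * A) j i = ((X * W) *ᵥ Aᵀ i) j := rfl
  rw [this, Matrix.transpose_apply]
  ring

theorem exists_rank_factorization (P : Matrix (Fin n) (Fin n) ℝ) (hP : P.rank = q) :
    ∃ (B : Matrix (Fin n) (Fin q) ℝ) (C : Matrix (Fin q) (Fin n) ℝ), P = B * C ∧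
      ∀ l, ∃ w, Bᵀ l = P *ᵥ w := by
  have h1 : Module.finrank ℝ P.mulVecLin.range = q := hP
  let b := Module.finBasisOfFinrankEq ℝ _ h1
  refine ⟨Matrix.of fun j l => (b l : Fin n → ℝ) j,
    Matrix.of fun l j => b.repr ⟨P *ᵥ Pi.single j 1, _, rfl⟩ l, ?_, fun l => ?_⟩
  · ext i j
    have h := congrArg Subtype.val (b.sum_repr ⟨P *ᵥ Pi.single j 1, _, rfl⟩)
    have h2 := congrFun h i
    simp only [Submodule.coe_sum, Finset.sum_apply, Submodule.coe_smul, Pi.smul_apply,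
      smul_eq_mul, Matrix.mulVec_single_one, Matrix.col_apply] at h2
    rw [← h2, Matrix.mul_apply]
    refine Finset.sum_congr rfl fun l _ => ?_
    simp only [Matrix.of_apply, Matrix.mulVec_single_one]
    ring
  · obtain ⟨w, hw⟩ := (b l).2
    exact ⟨w, hw.symm⟩

/-- Factor `P = B C` through rank `q`. The columns of `B` lie in the range of `P`, hence in that of
`X`, so `B = X W`; with `A = C Y` the predictions are `P Y`. -/
theorem exists_loss_eq (X : Matrix (Fin n) (Fin p) ℝ) (Y : Matrix (Fin n) (Fin k) ℝ)
    {v : Fin k → ℝ} (hv : v ∈ feasibleRegion (optPred X Y) q) :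
    ∃ (W : Matrix (Fin p) (Fin q) ℝ) (A : Matrix (Fin q) (Fin k) ℝ),
      loss X Y W A = sqNorms Y - v := by
  obtain ⟨P, hP, hv⟩ := (mem_feasibleRegion_iff _ _ _).1 hv
  obtain ⟨B, C, hBC, hB⟩ := exists_rank_factorization P hP.rank
  choose z hz using exists_optPred_eq_mulVec X Y
  have hYh : optPred X Y = X * (Matrix.of z)ᵀ := by
    ext j i
    exact congrFun (hz i) j
  have hrange : ∀ w, ∃ a, P *ᵥ w = X *ᵥ a := fun w => by
    obtain ⟨a, ha⟩ := hP.range w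
    exact ⟨(Matrix.of z)ᵀ *ᵥ a, by rw [← ha, Matrix.mulVec_mulVec, ← hYh]⟩
  have hcol : ∀ l, ∃ a, Bᵀ l = X *ᵥ a := fun l => by
    obtain ⟨w, hw⟩ := hB l
    obtain ⟨a, ha⟩ := hrange w
    exact ⟨a, hw.trans ha⟩
  choose W hW using hcol
  have hXW : X * (Matrix.of W)ᵀ = B := by
    ext j l
    exact (congrFun (hW l) j).symm
  -- The residual `y_i - ŷ_i` is orthogonal to the range of `X`, which contains that of `P`.
  have hPy : ∀ i, P *ᵥ Yᵀ i = P *ᵥ (optPred X Y)ᵀ i := fun i => by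
    obtain ⟨a, ha⟩ := hrange (Yᵀ i - (optPred X Y)ᵀ i)
    rw [← sub_eq_zero, ← Matrix.mulVec_sub, ← dotProduct_self_eq_zero,
      dotProduct_mulVec_symm hP.symm, Matrix.mulVec_mulVec, hP.idem, dotProduct_comm, ha,
      dotProduct_sub, mulVec_dotProduct_optPred, sub_self]
  refine ⟨(Matrix.of W)ᵀ, C * Y, ?_⟩
  ext i
  have hb : (X * (Matrix.of W)ᵀ) *ᵥ (C * Y)ᵀ i = P *ᵥ (optPred X Y)ᵀ i := by
    have : (C * Y)ᵀ i = C *ᵥ Yᵀ i := rfl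
    rw [hXW, this, Matrix.mulVec_mulVec, ← hBC, hPy]
  rw [loss_eq, hb, Pi.sub_apply, hv, dotProduct_mulVec_symm hP.symm, Matrix.mulVec_mulVec,
    hP.idem, dotProduct_comm (P *ᵥ _)]
  ring

theorem exists_le_finrank_eq (V : Submodule ℝ (Fin k → ℝ)) :
    ∀ d, Module.finrank ℝ V ≤ d → d ≤ k → ∃ U, V ≤ U ∧ Module.finrank ℝ U = d := by
  intro d hd
  induction d, hd using Nat.le_induction with
  | base => exact fun _ => ⟨V, le_rfl, rfl⟩
  | succ m hm ih =>
    intro hmk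
    obtain ⟨U, hU, hUm⟩ := ih (by omega)
    have : Module.finrank ℝ U < Module.finrank ℝ (Fin k → ℝ) := by
      rw [Module.finrank_fin_fun]
      omega
    obtain ⟨x, hx⟩ := U.exists_of_finrank_lt this
    have hxU : x ∉ U := by simpa using hx 1 one_ne_zero
    exact ⟨_, hU.trans le_sup_left, by rw [Submodule.finrank_sup_span_singleton hxU, hUm]⟩

/-- The layer may have rank below `q`, while feasible projections have rank exactly `q`; enlarging
the range repairs this. -/
theorem exists_injective_range_le (hq : q ≤ k) (C : Matrix (Fin k) (Fin q) ℝ) :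
    ∃ C' : Matrix (Fin k) (Fin q) ℝ, Function.Injective C'.mulVec ∧
      ∀ a, ∃ a', C' *ᵥ a' = C *ᵥ a := by
  have hr : Module.finrank ℝ C.mulVecLin.range ≤ q := C.rank_le_width
  obtain ⟨U, hU, hUq⟩ := exists_le_finrank_eq _ q hr hq
  let b := Module.finBasisOfFinrankEq ℝ U hUq
  have hb : LinearIndependent ℝ fun l => (b l : Fin k → ℝ) :=
    b.linearIndependent.map' U.subtype U.ker_subtype
  refine ⟨(Matrix.of fun l => (b l : Fin k → ℝ))ᵀ,
    mulVec_injective_of_linearIndependent hb, fun a => ?_⟩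
  have ha : C *ᵥ a ∈ U := hU ⟨a, rfl⟩
  refine ⟨b.repr ⟨_, ha⟩, ?_⟩
  have h := congrArg Subtype.val (b.sum_repr ⟨_, ha⟩)
  ext i
  have h2 := congrFun h i
  simp only [Submodule.coe_sum, Finset.sum_apply, Submodule.coe_smul, Pi.smul_apply,
      smul_eq_mul] at h2
  rw [← h2]
  simp only [Matrix.mulVec, dotProduct, Matrix.transpose_apply, Matrix.of_apply]
  exact Finset.sum_congr rfl fun l _ => mul_comm _ _

/-- Projecting a prediction `b` to `b'` in the span of the `ŷ_i` keeps its product with `ŷ_i` and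
does not lengthen it. All these `b'` lie in the range of one rank-`q` projection `P`, and `2 b'·ŷ -
‖b'‖² ≤ ‖P ŷ‖²` by completing the square. -/
theorem exists_feasible_ge_loss {X : Matrix (Fin n) (Fin p) ℝ} {Y : Matrix (Fin n) (Fin k) ℝ}
    (hY : Function.Injective (optPred X Y).mulVec) (hq : q ≤ k)
    (W : Matrix (Fin p) (Fin q) ℝ) (A : Matrix (Fin q) (Fin k) ℝ) :
    ∃ v ∈ feasibleRegion (optPred X Y) q, sqNorms Y - v ≤ loss X Y W A := by
  set Yh := optPred X Y with hYh
  obtain ⟨C', hC', hr⟩ := exists_injective_range_le hq ((Yhᵀ * Yh)⁻¹ * Yhᵀ * (X * W))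
  have hinj : Function.Injective (Yh * C').mulVec := by
    have : (Yh * C').mulVec = Yh.mulVec ∘ C'.mulVec := by
      ext1 a
      exact (Matrix.mulVec_mulVec a Yh C').symm
    rw [this]
    exact hY.comp hC'
  have hP := isProjIn_projMat C' hinj
  set P := projMat (Yh * C')
  refine ⟨fun i => Yhᵀ i ⬝ᵥ P *ᵥ Yhᵀ i, (mem_feasibleRegion_iff _ _ _).2 ⟨P, hP, fun _ => rfl⟩,
    fun i => ?_⟩
  rw [loss_eq, Pi.sub_apply]
  apply sub_le_sub_left
  set b := (X * W) *ᵥ Aᵀ i with hb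
  set y := Yhᵀ i with hy
  set b' := projMat Yh *ᵥ b with hb'
  have hb'P : P *ᵥ b' = b' := by
    obtain ⟨a', ha'⟩ := hr (Aᵀ i)
    have : b' = (Yh * C') *ᵥ a' := by
      rw [hb', projMat_mulVec_eq, ← Matrix.mulVec_mulVec, ha', hb]
      simp only [Matrix.mulVec_mulVec, Matrix.mul_assoc]
    rw [this, projMat_mulVec hinj]
  have hsym := projMat_isSymm hY
  have h1 : b ⬝ᵥ y = b' ⬝ᵥ P *ᵥ y := by
    have hy' : projMat Yh *ᵥ y = y := by
      rw [hy, transpose_apply_eq_mulVec, projMat_mulVec hY]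
    rw [dotProduct_mulVec_symm hP.symm, hb'P, hb', dotProduct_mulVec_symm hsym, hy']
  have h2 : b ⬝ᵥ b' = b' ⬝ᵥ b' := by
    conv_rhs => rw [hb', dotProduct_mulVec_symm hsym, Matrix.mulVec_mulVec, projMat_mul_self hY]
  have h3 := dotProduct_self_nonneg_real (b - b')
  have h4 := dotProduct_self_nonneg_real (b' - P *ᵥ y)
  have h5 : (P *ᵥ y) ⬝ᵥ (P *ᵥ y) = y ⬝ᵥ P *ᵥ y := by
    rw [dotProduct_mulVec_symm hP.symm, Matrix.mulVec_mulVec, hP.idem]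
  simp only [sub_dotProduct, dotProduct_sub] at h3 h4
  rw [dotProduct_comm b' b, h2] at h3
  rw [dotProduct_comm (P *ᵥ y) b', h5] at h4
  rw [h1]
  linarith

theorem sub_mem_lossFront {X : Matrix (Fin n) (Fin p) ℝ} {Y : Matrix (Fin n) (Fin k) ℝ}
    (hY : Function.Injective (optPred X Y).mulVec) (hq : q ≤ k) {v : Fin k → ℝ}
    (hv : v ∈ paretoFront (optPred X Y) q) : sqNorms Y - v ∈ lossFront X Y q := by
  obtain ⟨W, A, hWA⟩ := exists_loss_eq X Y hv.1
  refine ⟨W, A, ?_, hWA⟩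
  rintro ⟨W', A', hle, i, hlt⟩
  obtain ⟨v', hv', hloss⟩ := exists_feasible_ge_loss hY hq W' A'
  rw [hWA] at hle hlt
  have h1 : v ≤ v' := fun j => by
    have h2 := hle j
    have h3 := hloss j
    simp only [Pi.sub_apply] at h2 h3
    linarith
  have h2 := hv.2 hv' h1 i
  have h3 := hloss i
  simp only [Pi.sub_apply] at h3 hlt
  linarith

theorem exists_weights_of_reached {X : Matrix (Fin n) (Fin p) ℝ} {Y : Matrix (Fin n) (Fin k) ℝ}
    {v : Fin k → ℝ} (h : ReachedByScalarization X Y q (sqNorms Y - v)) :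
    ∃ c ∈ stdSimplex ℝ (Fin k), ∀ v' ∈ feasibleRegion (optPred X Y) q, c ⬝ᵥ v' ≤ c ⬝ᵥ v := by
  obtain ⟨c, hc, W, A, hmin, hWA⟩ := h
  refine ⟨c, hc, fun v' hv' => ?_⟩
  obtain ⟨W', A', hWA'⟩ := exists_loss_eq X Y hv'
  have := hmin W' A'
  rw [hWA, hWA'] at this
  simp only [Pi.sub_apply, mul_sub, Finset.sum_sub_distrib] at this
  simp only [dotProduct]
  linarith

end Loss

/-! ### Surfaces, gradients and Lagrange multipliers -/

section Surfaces

open Matrix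

variable {n k : ℕ}

theorem sqrt_sq_of_nonneg {x : Fin k → ℝ} (hx : 0 ≤ x) : (fun i => √((x ^ 2) i)) = x :=
  funext fun i => Real.sqrt_sq (hx i)

theorem sqrt_pow_two_of_nonneg {v : Fin k → ℝ} (hv : 0 ≤ v) : (fun i => √(v i)) ^ 2 = v :=
  funext fun i => Real.sq_sqrt (hv i)

theorem sqrtForm_sq (Yh : Matrix (Fin n) (Fin k) ℝ) (T : Finset (Fin k)) {x : Fin k → ℝ}
    (hx : 0 ≤ x) : sqrtForm Yh T (x ^ 2) = quad (flip (Yhᵀ * Yh)⁻¹ T) x := by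
  rw [sqrtForm, sqrt_sq_of_nonneg hx]
  rfl

theorem mem_surfE_iff (Yh : Matrix (Fin n) (Fin k) ℝ) (T : Finset (Fin k)) (v : Fin k → ℝ) :
    v ∈ surfE Yh T ↔ ∃ x, 0 ≤ x ∧ quad (flip (Yhᵀ * Yh)⁻¹ T) x = 1 ∧ v = x ^ 2 := by
  constructor
  · rintro ⟨hv, h⟩
    exact ⟨fun i => √(v i), fun i => Real.sqrt_nonneg _, h, (sqrt_pow_two_of_nonneg hv).symm⟩
  · rintro ⟨x, hx, h, rfl⟩
    exact ⟨fun i => sq_nonneg (x i), (sqrtForm_sq Yh T hx).trans h⟩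

theorem sq_mem_surfE_iff (Yh : Matrix (Fin n) (Fin k) ℝ) (T : Finset (Fin k)) {x : Fin k → ℝ}
    (hx : 0 ≤ x) : x ^ 2 ∈ surfE Yh T ↔ quad (flip (Yhᵀ * Yh)⁻¹ T) x = 1 := by
  rw [← sqrtForm_sq Yh T hx]
  exact ⟨fun h => h.2, fun h => ⟨fun i => sq_nonneg (x i), h⟩⟩

theorem mem_surfI_iff_mem_surfE (Yh : Matrix (Fin n) (Fin k) ℝ) (T : Finset (Fin k))
    (v : Fin k → ℝ) : v ∈ surfI Yh T ↔ sqNorms Yh - v ∈ surfE Yh T :=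
  and_congr_left' sub_nonneg.symm

/-- By homogeneity the unit level set in the nonnegative orthant determines the form there, hence
the matrix. -/
theorem surfE_ne_of_flip_ne {Yh : Matrix (Fin n) (Fin k) ℝ} (hY : Function.Injective Yh.mulVec)
    {T T' : Finset (Fin k)} (h : flip (Yhᵀ * Yh)⁻¹ T ≠ flip (Yhᵀ * Yh)⁻¹ T') :
    surfE Yh T ≠ surfE Yh T' := by
  have hQ := (isPD_gram hY).inv
  intro hS
  refine h (eq_of_quad_eq_on_nonneg (hQ.flip T).symm (hQ.flip T').symm fun x hx => ?_)
  by_cases hx0 : x = 0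
  · simp [hx0, quad]
  have hp := (hQ.flip T).pos x hx0
  have hcx : 0 ≤ (√(quad (flip (Yhᵀ * Yh)⁻¹ T) x))⁻¹ • x := smul_nonneg (by positivity) hx
  have h1 := (sq_mem_surfE_iff Yh T hcx).2 ((hQ.flip T).quad_normalize hx0)
  rw [hS, sq_mem_surfE_iff Yh T' hcx, quad_smul, inv_pow, Real.sq_sqrt hp.le,
    inv_mul_eq_one₀ hp.ne'] at h1
  exact h1

theorem surfI_ne_of_flip_ne {Yh : Matrix (Fin n) (Fin k) ℝ} (hY : Function.Injective Yh.mulVec)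
    {T T' : Finset (Fin k)} (h : flip (Yhᵀ * Yh)⁻¹ T ≠ flip (Yhᵀ * Yh)⁻¹ T') :
    surfI Yh T ≠ surfI Yh T' := by
  intro hS
  refine surfE_ne_of_flip_ne hY h (Set.ext fun v => ?_)
  have := Set.ext_iff.1 hS (sqNorms Yh - v)
  rwa [mem_surfI_iff_mem_surfE, mem_surfI_iff_mem_surfE, sub_sub_cancel] at this

theorem flip_ne_of_surfE_ne {Yh : Matrix (Fin n) (Fin k) ℝ}
    {T T' : Finset (Fin k)} (h : surfE Yh T ≠ surfE Yh T') :
    flip (Yhᵀ * Yh)⁻¹ T ≠ flip (Yhᵀ * Yh)⁻¹ T' := by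
  intro hf
  refine h (Set.ext fun v => ?_)
  rw [mem_surfE_iff, mem_surfE_iff, hf]

/-- Positivity of `x` keeps the square roots differentiable. Symmetry contributes a factor `2`,
which cancels the one in `1 / (2 * x i)`. -/
theorem hasFDerivAt_sqrtForm {Yh : Matrix (Fin n) (Fin k) ℝ} (hY : Function.Injective Yh.mulVec)
    (T : Finset (Fin k)) {x : Fin k → ℝ} (hx : ∀ i, 0 < x i) :
    HasFDerivAt (sqrtForm Yh T)
      (∑ i, ((flip (Yhᵀ * Yh)⁻¹ T *ᵥ x) i / x i) •
        ContinuousLinearMap.proj (R := ℝ) (φ := fun _ : Fin k => ℝ) i)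
      (x ^ 2) := by
  have hM := ((isPD_gram hY).inv.flip T).symm
  set M := flip (Yhᵀ * Yh)⁻¹ T with hMdef
  have hs : ∀ i, HasFDerivAt (fun w : Fin k → ℝ => √(w i))
      ((1 / (2 * x i)) • ContinuousLinearMap.proj (R := ℝ) (φ := fun _ : Fin k => ℝ) i)
      (x ^ 2) := fun i => by
    have h0 : HasFDerivAt (fun w : Fin k → ℝ => w i) _ (x ^ 2) :=
      hasFDerivAt_apply (𝕜 := ℝ) i (x ^ 2)
    have h := h0.sqrt (pow_pos (hx i) 2).ne'
    have e : √((x ^ 2) i) = x i := Real.sqrt_sq (hx i).le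
    rwa [e] at h
  have hform : sqrtForm Yh T = fun w => ∑ i, √(w i) * ∑ j, M i j * √(w j) := rfl
  rw [hform]
  have h := HasFDerivAt.fun_sum (u := Finset.univ) fun i _ => (hs i).fun_mul
    (HasFDerivAt.fun_sum (u := Finset.univ) fun j _ => (hs j).const_mul (M i j))
  refine h.congr_fderiv ?_
  have e : ∀ i, √((x ^ 2) i) = x i := fun i => Real.sqrt_sq (hx i).le
  ext w
  simp only [e, _root_.sum_apply, _root_.add_apply,
    _root_.smul_apply, ContinuousLinearMap.proj_apply, smul_eq_mul,
    Finset.sum_add_distrib, Finset.mul_sum]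
  rw [Finset.sum_comm, ← Finset.sum_add_distrib]
  refine Finset.sum_congr rfl fun i _ => ?_
  have h1 : ∑ j, x j * (M j i * (1 / (2 * x i) * w i)) = (M *ᵥ x) i * (1 / (2 * x i) * w i) := by
    rw [Matrix.mulVec, dotProduct, Finset.sum_mul]
    refine Finset.sum_congr rfl fun j _ => ?_
    rw [hM.apply i j]
    ring
  have h2 : ∑ j, M i j * x j = (M *ᵥ x) i := rfl
  rw [h1, h2]
  field_simp
  ring

/-- The form has degree one in `v`, so by Euler's identity every gradient pairs with `v` to the same
nonzero value; on a common ray two gradients would therefore coincide. -/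
theorem not_sameRay_of_dotProduct_eq {a b v : Fin k → ℝ} {c : ℝ} (hc : c ≠ 0)
    (ha : a ⬝ᵥ v = c) (hb : b ⬝ᵥ v = c) (hab : a ≠ b) : ¬ SameRay ℝ a b := by
  rintro (h | h | ⟨r, s, hr, hs, h⟩)
  · rw [h, zero_dotProduct] at ha
    exact hc ha.symm
  · rw [h, zero_dotProduct] at hb
    exact hc hb.symm
  · have h1 := congrArg (· ⬝ᵥ v) h
    simp only [smul_dotProduct, ha, hb, smul_eq_mul] at h1
    have h2 := mul_right_cancel₀ hc h1
    rw [h2] at h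
    exact hab (smul_right_injective _ hs.ne' h)

theorem sum_smul_proj_single (a : Fin k → ℝ) (i : Fin k) :
    (∑ j, a j • ContinuousLinearMap.proj (R := ℝ) (φ := fun _ : Fin k => ℝ) j)
      (Pi.single i 1) = a i := by
  simp [Pi.single_apply]

theorem div_dotProduct_sq {a x : Fin k → ℝ} (hx : ∀ i, 0 < x i) :
    (fun i => a i / x i) ⬝ᵥ (x ^ 2) = x ⬝ᵥ a := by
  refine Finset.sum_congr rfl fun i _ => ?_
  have := (hx i).ne'
  simp only [Pi.pow_apply]
  field_simp

theorem div_ne_div {a b x : Fin k → ℝ} (hx : ∀ i, 0 < x i) (hab : a ≠ b) :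
    (fun i => a i / x i) ≠ fun i => b i / x i := by
  intro h
  refine hab (funext fun i => ?_)
  exact (div_left_inj' (hx i).ne').1 (congrFun h i)

theorem gradientsDisagree_formE {Yh : Matrix (Fin n) (Fin k) ℝ}
    (hY : Function.Injective Yh.mulVec) {T T' : Finset (Fin k)} {x : Fin k → ℝ}
    (hx : ∀ i, 0 < x i) (hT : quad (flip (Yhᵀ * Yh)⁻¹ T) x = 1)
    (hT' : quad (flip (Yhᵀ * Yh)⁻¹ T') x = 1)
    (hne : flip (Yhᵀ * Yh)⁻¹ T *ᵥ x ≠ flip (Yhᵀ * Yh)⁻¹ T' *ᵥ x) :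
    GradientsDisagree (formE Yh T) (formE Yh T') (x ^ 2) := by
  have hg : ∀ T, grad (formE Yh T) (x ^ 2) = fun i => (flip (Yhᵀ * Yh)⁻¹ T *ᵥ x) i / x i :=
    fun T => funext fun i => by
      have h : HasFDerivAt (formE Yh T) _ (x ^ 2) := hasFDerivAt_sqrtForm hY T hx
      rw [grad, h.fderiv, sum_smul_proj_single]
  refine ⟨(hasFDerivAt_sqrtForm hY T hx).differentiableAt,
    (hasFDerivAt_sqrtForm hY T' hx).differentiableAt, ?_⟩
  rw [hg, hg]
  exact not_sameRay_of_dotProduct_eq one_ne_zero ((div_dotProduct_sq hx).trans hT)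
    ((div_dotProduct_sq hx).trans hT') (div_ne_div hx hne)

theorem gradientsDisagree_formI {Yh : Matrix (Fin n) (Fin k) ℝ}
    (hY : Function.Injective Yh.mulVec) {T T' : Finset (Fin k)} {x : Fin k → ℝ}
    (hx : ∀ i, 0 < x i) (hT : quad (flip (Yhᵀ * Yh)⁻¹ T) x = 1)
    (hT' : quad (flip (Yhᵀ * Yh)⁻¹ T') x = 1)
    (hne : flip (Yhᵀ * Yh)⁻¹ T *ᵥ x ≠ flip (Yhᵀ * Yh)⁻¹ T' *ᵥ x) :
    GradientsDisagree (formI Yh T) (formI Yh T') (sqNorms Yh - x ^ 2) := by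
  have hd : ∀ T, HasFDerivAt (formI Yh T)
      (-∑ i, ((flip (Yhᵀ * Yh)⁻¹ T *ᵥ x) i / x i) •
        ContinuousLinearMap.proj (R := ℝ) (φ := fun _ : Fin k => ℝ) i)
      (sqNorms Yh - x ^ 2) := fun T => by
    have h := hasFDerivAt_sqrtForm hY T hx
    rw [← sub_sub_cancel (sqNorms Yh) (x ^ 2)] at h
    have h2 := h.comp (sqNorms Yh - x ^ 2) ((hasFDerivAt_id _).const_sub (sqNorms Yh))
    exact h2.congr_fderiv (by ext; simp)
  have hg : ∀ T, grad (formI Yh T) (sqNorms Yh - x ^ 2) =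
      -fun i => (flip (Yhᵀ * Yh)⁻¹ T *ᵥ x) i / x i :=
    fun T => funext fun i => by
      rw [grad, (hd T).fderiv, _root_.neg_apply, sum_smul_proj_single, Pi.neg_apply]
  refine ⟨(hd T).differentiableAt, (hd T').differentiableAt, ?_⟩
  rw [hg, hg, sameRay_neg_iff]
  exact not_sameRay_of_dotProduct_eq one_ne_zero ((div_dotProduct_sq hx).trans hT)
    ((div_dotProduct_sq hx).trans hT') (div_ne_div hx hne)

/-- The multiplier rule for a maximizer of a diagonal quadratic form on the unit level set of a
positive definite one. -/
theorem IsPD.lagrange {M : Matrix (Fin k) (Fin k) ℝ} (hM : IsPD M) {c x : Fin k → ℝ}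
    (hx : quad M x = 1) (hmax : ∀ w, quad M w = 1 → c ⬝ᵥ w ^ 2 ≤ c ⬝ᵥ x ^ 2) :
    (c ⬝ᵥ x ^ 2) • (M *ᵥ x) = c * x := by
  -- With `μ = c ⬝ᵥ x ^ 2`, maximality and homogeneity make the form of `μ M - diag c` nonnegative;
  -- it vanishes at `x`, so `x` lies in its kernel. No sign of `c` is involved.
  have hq : ∀ w, quad ((c ⬝ᵥ x ^ 2) • M - Matrix.diagonal c) w =
      (c ⬝ᵥ x ^ 2) * quad M w - c ⬝ᵥ w ^ 2 := fun w => by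
    rw [quad, Matrix.sub_mulVec, dotProduct_sub, Matrix.smul_mulVec, dotProduct_smul]
    congr 1
    simp only [dotProduct, Matrix.mulVec_diagonal, Pi.pow_apply]
    exact Finset.sum_congr rfl fun i _ => by ring
  have h := mulVec_eq_zero_of_quad_nonneg (Q := (c ⬝ᵥ x ^ 2) • M - Matrix.diagonal c)
    ((hM.symm.smul _).sub (Matrix.isSymm_diagonal c)) (fun w => ?_) (u := x) ?_
  · rw [Matrix.sub_mulVec, sub_eq_zero, Matrix.smul_mulVec] at h
    rw [h]
    ext i
    rw [Matrix.mulVec_diagonal, Pi.mul_apply]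
  · rw [hq]
    by_cases hw : w = 0
    · simp [hw, quad]
    · have h1 := hmax _ (hM.quad_normalize hw)
      have hp := hM.pos w hw
      rw [smul_pow, dotProduct_smul, inv_pow, Real.sq_sqrt hp.le, smul_eq_mul,
        inv_mul_le_iff₀ hp] at h1
      linarith
  · rw [hq, hx]
    ring

theorem dotProduct_sq_pos {c x : Fin k → ℝ} (hc : c ∈ stdSimplex ℝ (Fin k))
    (hx : ∀ i, 0 < x i) : 0 < c ⬝ᵥ x ^ 2 := by
  have h0 : ∀ i ∈ Finset.univ, 0 ≤ c i * (x ^ 2) i := fun i _ =>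
    mul_nonneg (hc.1 i) (sq_nonneg (x i))
  refine lt_of_le_of_ne (Finset.sum_nonneg h0) fun h => ?_
  have h1 := (Finset.sum_eq_zero_iff_of_nonneg h0).1 h.symm
  have h2 : ∑ i, c i = 0 := Finset.sum_eq_zero fun i hi =>
    (mul_eq_zero.1 (h1 i hi)).resolve_right (pow_pos (hx i) 2).ne'
  rw [hc.2] at h2
  exact one_ne_zero h2

theorem IsPD.lagrange_flip {Q : Matrix (Fin k) (Fin k) ℝ} (hQ : IsPD Q) (T : Finset (Fin k))
    {c x : Fin k → ℝ} (hx : quad (LinearMTL.flip Q T) x = 1)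
    (hmax : ∀ u, quad Q u = 1 → c ⬝ᵥ u ^ 2 ≤ c ⬝ᵥ x ^ 2) :
    (c ⬝ᵥ x ^ 2) • (LinearMTL.flip Q T *ᵥ x) = c * x := by
  refine (hQ.flip T).lagrange hx fun w hw => ?_
  rw [quad_flip] at hw
  have := hmax _ hw
  rwa [show (sgn T * w) ^ 2 = w ^ 2 from funext fun i => sgn_mul_sq T w i] at this

/-- A Pareto optimal point with positive coordinates on two surfaces whose gradients disagree
there is a witness against full exploration, for width `1`. -/
theorem witness_surfE {p : ℕ} {X : Matrix (Fin n) (Fin p) ℝ} {Y : Matrix (Fin n) (Fin k) ℝ}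
    {Yh : Matrix (Fin n) (Fin k) ℝ} (hYh : Yh = optPred X Y) (hk : 1 ≤ k)
    (hY : Function.Injective Yh.mulVec) {T T' : Finset (Fin k)} {x : Fin k → ℝ}
    (hx : ∀ i, 0 < x i) (hT : quad (flip (Yhᵀ * Yh)⁻¹ T) x = 1)
    (hT' : quad (flip (Yhᵀ * Yh)⁻¹ T') x = 1)
    (hne : flip (Yhᵀ * Yh)⁻¹ T *ᵥ x ≠ flip (Yhᵀ * Yh)⁻¹ T' *ᵥ x)
    (hPF : x ^ 2 ∈ paretoFront Yh 1) :
    ∃ T T' v, IsIntersectionPoint (paretoFront (optPred X Y) 1) (surfE (optPred X Y)) T T' v ∧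
      GradientsDisagree (formE (optPred X Y) T) (formE (optPred X Y) T') v ∧
      sqNorms Y - v ∈ lossFront X Y 1 ∧ ¬ ReachedByScalarization X Y 1 (sqNorms Y - v) := by
  have hQ := (isPD_gram hY).inv
  have hx0 : (0 : Fin k → ℝ) ≤ x := fun i => (hx i).le
  rw [← hYh]
  refine ⟨T, T', x ^ 2, ⟨hPF, surfE_ne_of_flip_ne hY fun h => hne (by rw [h]),
    (sq_mem_surfE_iff Yh T hx0).2 hT, (sq_mem_surfE_iff Yh T' hx0).2 hT'⟩,
    gradientsDisagree_formE hY hx hT hT' hne, ?_, fun hr => ?_⟩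
  · subst hYh
    exact sub_mem_lossFront hY hk hPF
  · obtain ⟨c, hc, hmax⟩ := exists_weights_of_reached hr
    rw [← hYh] at hmax
    have hmax' : ∀ u, quad (Yhᵀ * Yh)⁻¹ u = 1 → c ⬝ᵥ u ^ 2 ≤ c ⬝ᵥ x ^ 2 := fun u hu =>
      hmax _ ((mem_feasibleRegion_one hY _).2 ⟨u, hu, rfl⟩)
    have h1 := hQ.lagrange_flip T hT hmax'
    have h2 := hQ.lagrange_flip T' hT' hmax'
    -- Both multiplier equations have the right-hand side `c * x`, and the multiplier is positive
    -- because `x` is.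
    exact hne (smul_right_injective _ (dotProduct_sq_pos hc hx).ne' (h1.trans h2.symm))

/-- A Pareto optimal point with positive coordinates on two surfaces whose gradients disagree
there is a witness against full exploration, for width `k - 1`. -/
theorem witness_surfI {p : ℕ} {X : Matrix (Fin n) (Fin p) ℝ} {Y : Matrix (Fin n) (Fin k) ℝ}
    {Yh : Matrix (Fin n) (Fin k) ℝ} (hYh : Yh = optPred X Y) (hk : 1 ≤ k)
    (hY : Function.Injective Yh.mulVec) {T T' : Finset (Fin k)} {x : Fin k → ℝ}
    (hx : ∀ i, 0 < x i) (hT : quad (flip (Yhᵀ * Yh)⁻¹ T) x = 1)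
    (hT' : quad (flip (Yhᵀ * Yh)⁻¹ T') x = 1)
    (hne : flip (Yhᵀ * Yh)⁻¹ T *ᵥ x ≠ flip (Yhᵀ * Yh)⁻¹ T' *ᵥ x)
    (hPF : sqNorms Yh - x ^ 2 ∈ paretoFront Yh (k - 1)) :
    ∃ T T' v, IsIntersectionPoint (paretoFront (optPred X Y) (k - 1)) (surfI (optPred X Y)) T T' v ∧
      GradientsDisagree (formI (optPred X Y) T) (formI (optPred X Y) T') v ∧
      sqNorms Y - v ∈ lossFront X Y (k - 1) ∧
      ¬ ReachedByScalarization X Y (k - 1) (sqNorms Y - v) := by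
  have hQ := (isPD_gram hY).inv
  have hx0 : (0 : Fin k → ℝ) ≤ x := fun i => (hx i).le
  rw [← hYh]
  refine ⟨T, T', sqNorms Yh - x ^ 2, ⟨hPF, surfI_ne_of_flip_ne hY fun h => hne (by rw [h]),
    ?_, ?_⟩, gradientsDisagree_formI hY hx hT hT' hne, ?_, fun hr => ?_⟩
  · rwa [mem_surfI_iff_mem_surfE, sub_sub_cancel, sq_mem_surfE_iff Yh T hx0]
  · rwa [mem_surfI_iff_mem_surfE, sub_sub_cancel, sq_mem_surfE_iff Yh T' hx0]
  · subst hYh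
    exact sub_mem_lossFront hY (Nat.sub_le k 1) hPF
  · obtain ⟨c, hc, hmax⟩ := exists_weights_of_reached hr
    rw [← hYh] at hmax
    -- Maximizing `c ⬝ᵥ (t - u ^ 2)` is maximizing with the weights `-c`.
    have hmax' : ∀ u, quad (Yhᵀ * Yh)⁻¹ u = 1 → (-c) ⬝ᵥ u ^ 2 ≤ (-c) ⬝ᵥ x ^ 2 := fun u hu => by
      have := hmax _ ((mem_feasibleRegion_pred hk hY _).2 ⟨u, hu, rfl⟩)
      rw [dotProduct_sub, dotProduct_sub] at this
      rw [neg_dotProduct, neg_dotProduct]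
      linarith
    have h1 := hQ.lagrange_flip T hT hmax'
    have h2 := hQ.lagrange_flip T' hT' hmax'
    have hpos := dotProduct_sq_pos hc hx
    refine hne (smul_right_injective _ (?_ : (-c) ⬝ᵥ x ^ 2 ≠ 0) (h1.trans h2.symm))
    rw [neg_dotProduct]
    linarith

end Surfaces

/-! ### Width `k - 1` -/

section WidthPred

open Matrix

variable {n k : ℕ}

/-- If coordinate `i` had room `d`, the values after moving it by `d` and by `-d` would average to
`quad Q u + d ^ 2 * Q i i`, so one of them would exceed the maximum. -/
theorem IsPD.abs_eq_of_isMaxOn_box {Q : Matrix (Fin k) (Fin k) ℝ} (hQ : IsPD Q) {x u : Fin k → ℝ}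
    (hu : ∀ i, |u i| ≤ x i) (hmax : ∀ w, (∀ i, |w i| ≤ x i) → quad Q w ≤ quad Q u) (i : Fin k) :
    |u i| = x i := by
  by_contra hne
  have hlt : |u i| < x i := lt_of_le_of_ne (hu i) hne
  set d := x i - |u i| with hd
  have hdpos : 0 < d := sub_pos.2 hlt
  have hbox : ∀ e : ℝ, |e| ≤ d → ∀ j, |(u + Pi.single i e : Fin k → ℝ) j| ≤ x j := fun e he j => by
    by_cases hj : j = i
    · subst hj
      rw [Pi.add_apply, Pi.single_eq_same]
      calc |u j + e| ≤ |u j| + |e| := abs_add_le _ _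
        _ ≤ |u j| + d := by linarith
        _ = x j := by rw [hd]; ring
    · rw [Pi.add_apply, Pi.single_eq_of_ne hj, add_zero]
      exact hu j
  have h1 := hmax _ (hbox d (abs_of_pos hdpos).le)
  have h2 := hmax _ (hbox (-d) (by rw [abs_neg, abs_of_pos hdpos]))
  rw [quad_add_single hQ.symm] at h1 h2
  have h3 : 0 < d ^ 2 * Q i i := mul_pos (pow_pos hdpos 2) (hQ.diag_pos i)
  nlinarith

/-- A vector of a box at which a positive definite form is at least as large as at all vertices is
a vertex. -/
theorem IsPD.sq_eq_of_mem_box {Q : Matrix (Fin k) (Fin k) ℝ} (hQ : IsPD Q) {x u : Fin k → ℝ}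
    (hu : ∀ i, |u i| ≤ x i) (h : ∀ T, quad (LinearMTL.flip Q T) x ≤ quad Q u) : u ^ 2 = x ^ 2 := by
  have hbox : ∀ w : Fin k → ℝ, (∀ i, |w i| ≤ x i) ↔ w ∈ Set.Icc (-x) x := fun w => by
    simp only [abs_le, forall_and, Set.mem_Icc, Pi.le_def, Pi.neg_apply]
  obtain ⟨m, hm, hmax⟩ := isCompact_Icc.exists_isMaxOn ⟨u, (hbox u).1 hu⟩
    (continuous_quad Q).continuousOn
  have hmax' : ∀ w, (∀ i, |w i| ≤ x i) → quad Q w ≤ quad Q m := fun w hw => hmax ((hbox w).1 hw)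
  have hmx := hQ.abs_eq_of_isMaxOn_box ((hbox m).2 hm) hmax'
  obtain ⟨T, hT⟩ := exists_eq_sgn_mul_abs m
  have hmu : quad Q m ≤ quad Q u := by
    have := h T
    rw [quad_flip, ← funext hmx] at this
    rwa [hT]
  -- The maximizer `m` is a vertex, so the hypothesis on vertices makes `u` a maximizer too.
  have := hQ.abs_eq_of_isMaxOn_box hu fun w hw => (hmax' w hw).trans hmu
  ext i
  rw [Pi.pow_apply, Pi.pow_apply, ← this i, sq_abs]

/-- A dominating point comes from some `u` in the box `|u| ≤ x` whose value `1` is at least that of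
every vertex, so `u` is itself a vertex. -/
theorem sub_sq_mem_paretoFront_pred {Yh : Matrix (Fin n) (Fin k) ℝ} (hk : 1 ≤ k)
    (hY : Function.Injective Yh.mulVec) {T : Finset (Fin k)} {x : Fin k → ℝ} (hx : 0 ≤ x)
    (hT : quad (flip (Yhᵀ * Yh)⁻¹ T) x = 1)
    (hmax : ∀ T', quad (flip (Yhᵀ * Yh)⁻¹ T') x ≤ 1) :
    sqNorms Yh - x ^ 2 ∈ paretoFront Yh (k - 1) := by
  have hQ := (isPD_gram hY).inv
  refine ⟨(mem_feasibleRegion_pred hk hY _).2 ⟨sgn T * x, by rwa [← quad_flip], ?_⟩, ?_⟩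
  · congr 1
    exact funext fun i => (sgn_mul_sq T x i).symm
  · intro v hv hle
    obtain ⟨u, hu, rfl⟩ := (mem_feasibleRegion_pred hk hY _).1 hv
    have hux : ∀ i, |u i| ≤ x i := fun i => by
      have := hle i
      simp only [Pi.sub_apply, Pi.pow_apply] at this
      exact abs_le_of_sq_le_sq (by linarith) (hx i)
    rw [hQ.sq_eq_of_mem_box hux fun T' => (hmax T').trans hu.ge]

/-- If two forms have equal values and gradients at a point, their difference along a line through
the point is a multiple of the square of the parameter. -/
theorem quad_sub_quad_of_mulVec_eq {M N : Matrix (Fin k) (Fin k) ℝ} (hM : M.IsSymm)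
    (hN : N.IsSymm) {x : Fin k → ℝ} (h : quad M x = quad N x) (hg : M *ᵥ x = N *ᵥ x)
    (c : ℝ) (w : Fin k → ℝ) :
    quad M (x + c • w) - quad N (x + c • w) = c ^ 2 * (quad M w - quad N w) := by
  rw [quad_add hM, quad_add hN, h, hg, quad_smul, quad_smul]
  ring

/-- If ties between maximal sign patterns never come with different gradients, then a pattern that
is maximal at the start of a segment stays maximal. -/
theorem maximal_of_segment {Q : Matrix (Fin k) (Fin k) ℝ} (hQ : IsPD Q)
    (htie : ∀ T T' x, (∀ i, 0 < x i) → quad (flip Q T) x = quad (flip Q T') x →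
      (∀ T'', quad (flip Q T'') x ≤ quad (flip Q T) x) → flip Q T *ᵥ x = flip Q T' *ᵥ x)
    {T : Finset (Fin k)} {a b : Fin k → ℝ} (ha : ∀ i, 0 < a i) (hb : ∀ i, 0 < b i)
    (h0 : ∀ᶠ x in 𝓝 a, ∀ T', quad (flip Q T') x ≤ quad (flip Q T) x) (T' : Finset (Fin k)) :
    quad (flip Q T') b ≤ quad (flip Q T) b := by
  set p : ℝ → Fin k → ℝ := fun r => a + r • (b - a) with hp
  have hpc : Continuous p := by fun_prop
  have hp0 : p 0 = a := by simp [hp]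
  have hp1 : p 1 = b := by simp [hp]
  have hppos : ∀ r ∈ Set.Icc (0 : ℝ) 1, ∀ i, 0 < p r i := fun r hr i => by
    have : p r i = (1 - r) * a i + r * b i := by
      simp only [hp, Pi.add_apply, Pi.smul_apply, Pi.sub_apply, smul_eq_mul]
      ring
    rw [this]
    rcases hr.1.eq_or_lt with h | h
    · rw [← h]
      simpa using ha i
    · exact add_pos_of_nonneg_of_pos (mul_nonneg (sub_nonneg.2 hr.2) (ha i).le) (mul_pos h (hb i))
  set s : Set ℝ := {r | ∀ T', quad (flip Q T') (p r) ≤ quad (flip Q T) (p r)} with hs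
  have hsc : IsClosed s := by
    rw [hs, Set.ofPred_forall]
    exact isClosed_iInter fun T' =>
      isClosed_le ((continuous_quad _).comp hpc) ((continuous_quad _).comp hpc)
  have hev : ∀ r ∈ s ∩ Set.Ico (0 : ℝ) 1, ∀ᶠ r' in 𝓝 r, r' ∈ s := by
    rintro r ⟨hrs, hr⟩
    -- At `r = 0` a tie says nothing about the sign of the quadratic coefficient, so there the
    -- neighbourhood in `h0` is needed. For `r > 0` the value at the start of the segment decides
    -- that sign.
    rcases hr.1.eq_or_lt with h | h
    · rw [← h]
      exact hpc.continuousAt.eventually (by rwa [hp0])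
    · refine Filter.eventually_all.2 fun T' => ?_
      rcases (hrs T').lt_or_eq with hlt | heq
      · have := ((continuous_quad (flip Q T')).comp hpc).continuousAt.eventually_lt
          ((continuous_quad (flip Q T)).comp hpc).continuousAt hlt
        exact this.mono fun _ h => h.le
      · have hg := htie T T' (p r) (hppos r ⟨hr.1, hr.2.le⟩) heq.symm hrs
        have hline : ∀ r', quad (flip Q T) (p r') - quad (flip Q T') (p r') =
            (r' - r) ^ 2 * (quad (flip Q T) (b - a) - quad (flip Q T') (b - a)) := fun r' => by
          rw [← quad_sub_quad_of_mulVec_eq (hQ.flip T).symm (hQ.flip T').symm heq.symm hg]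
          have : p r + (r' - r) • (b - a) = p r' := by
            simp only [hp, sub_smul]
            abel
          rw [this]
        have hz := h0.self_of_nhds T'
        have hline0 := hline 0
        rw [hp0] at hline0
        have hc : 0 ≤ quad (flip Q T) (b - a) - quad (flip Q T') (b - a) := by
          by_contra hneg
          have : (0 - r) ^ 2 * (quad (flip Q T) (b - a) - quad (flip Q T') (b - a)) < 0 :=
            mul_neg_of_pos_of_neg (by nlinarith) (not_le.1 hneg)
          linarith
        refine Filter.Eventually.of_forall fun r' => ?_
        have := hline r'
        have h2 := mul_nonneg (sq_nonneg (r' - r)) hc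
        linarith
  have h0s : (0 : ℝ) ∈ s := fun T' => by
    rw [hp0]
    exact h0.self_of_nhds T'
  have hsub := (hsc.inter isClosed_Icc).Icc_subset_of_forall_exists_gt h0s fun r hr y hy => by
    obtain ⟨r', hr', hmem⟩ := (((hev r hr).filter_mono nhdsWithin_le_nhds).and
      (Ioc_mem_nhdsGT hy)).exists
    exact ⟨r', hr', hmem⟩
  have := hsub (Set.right_mem_Icc.2 zero_le_one) T'
  rwa [hp1] at this

/-- Some sign pattern is maximal on an open set of positive vectors. -/
theorem exists_eventually_maximal (Q : Matrix (Fin k) (Fin k) ℝ) :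
    ∃ (T : Finset (Fin k)) (a : Fin k → ℝ), (∀ i, 0 < a i) ∧
      ∀ᶠ x in 𝓝 a, ∀ T', quad (flip Q T') x ≤ quad (flip Q T) x := by
  -- Exponential coordinates turn the open orthant into the complete space `ℝ^k`, which finitely
  -- many closed sets cover; by Baire one of them has interior.
  let E : (Fin k → ℝ) → Fin k → ℝ := fun y i => Real.exp (y i)
  have hE : Continuous E := by fun_prop
  obtain ⟨T, y, hy⟩ := nonempty_interior_of_iUnion_of_closed
    (f := fun T => {y | ∀ T', quad (flip Q T') (E y) ≤ quad (flip Q T) (E y)})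
    (fun T => by
      rw [Set.ofPred_forall]
      exact isClosed_iInter fun T' =>
        isClosed_le ((continuous_quad _).comp hE) ((continuous_quad _).comp hE))
    (by
      refine Set.eq_univ_of_forall fun y => ?_
      obtain ⟨T, -, hT⟩ := Finset.exists_max_image Finset.univ
        (fun T => quad (flip Q T) (E y)) ⟨∅, Finset.mem_univ _⟩
      exact Set.mem_iUnion.2 ⟨T, fun T' => hT T' (Finset.mem_univ _)⟩)
  refine ⟨T, E y, fun i => Real.exp_pos _, ?_⟩
  have hlog : Filter.Tendsto (fun (x : Fin k → ℝ) i => Real.log (x i)) (𝓝 (E y)) (𝓝 y) := by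
    rw [tendsto_pi_nhds]
    intro i
    have h1 : Filter.Tendsto (fun x : Fin k → ℝ => x i) (𝓝 (E y)) (𝓝 (E y i)) :=
      (continuous_apply i).continuousAt
    have h2 := h1.log (Real.exp_pos _).ne'
    simpa only [E, Real.log_exp] using h2
  have hpos : ∀ᶠ x in 𝓝 (E y), ∀ i, 0 < x i := Filter.eventually_all.2 fun i =>
    (continuous_apply i).continuousAt.eventually (lt_mem_nhds (Real.exp_pos (y i)))
  filter_upwards [hlog.eventually (mem_interior_iff_mem_nhds.1 hy), hpos] with x hx hxpos
  have : E (fun i => Real.log (x i)) = x := funext fun i => Real.exp_log (hxpos i)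
  simpa only [Set.mem_ofPred_eq, this] using hx

/-- If no sign pattern makes the matrix nonnegative, then at some positive vector two maximal sign
patterns tie with different gradients. -/
theorem exists_tie_of_not_nonneg {Q : Matrix (Fin k) (Fin k) ℝ} (hQ : IsPD Q)
    (h : ¬ ∃ T, ∀ i j, 0 ≤ flip Q T i j) :
    ∃ T T' x, (∀ i, 0 < x i) ∧ quad (flip Q T) x = quad (flip Q T') x ∧
      (∀ T'', quad (flip Q T'') x ≤ quad (flip Q T) x) ∧
      flip Q T *ᵥ x ≠ flip Q T' *ᵥ x := by
  by_contra hcon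
  push Not at hcon
  obtain ⟨T, a, ha, h0⟩ := exists_eventually_maximal Q
  refine h ⟨T, fun i j => ?_⟩
  by_cases hij : i = j
  · subst hij
    rw [flip_diag]
    exact (hQ.diag_pos i).le
  have hmax : ∀ b : Fin k → ℝ, (∀ i, 0 < b i) → ∀ T', quad (flip Q T') b ≤ quad (flip Q T) b :=
    fun b hb => maximal_of_segment hQ hcon ha hb h0
  have hlim : ∀ b : Fin k → ℝ, 0 ≤ b → ∀ T', quad (flip Q T') b ≤ quad (flip Q T) b := by
    intro b hb T'
    have hc : Continuous fun e : ℝ => b + e • (1 : Fin k → ℝ) := by fun_prop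
    have ht : ∀ T, Filter.Tendsto (fun e : ℝ => quad (flip Q T) (b + e • (1 : Fin k → ℝ)))
        (𝓝[>] 0) (𝓝 (quad (flip Q T) b)) := fun T => by
      have := (((continuous_quad (flip Q T)).comp hc).tendsto 0).mono_left
        (nhdsWithin_le_nhds (s := Set.Ioi 0))
      simpa [Function.comp_def] using this
    refine le_of_tendsto_of_tendsto (ht T') (ht T) ?_
    filter_upwards [self_mem_nhdsWithin] with e he
    refine hmax _ (fun i => ?_) T'
    simpa using add_pos_of_nonneg_of_pos (hb i) he
  have hs : ∀ i : Fin k, (0 : Fin k → ℝ) ≤ Pi.single i 1 := fun i =>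
    Pi.single_nonneg.2 zero_le_one
  -- Flipping `i` alone negates the `(i, j)` entry and keeps the diagonal, so maximality at `e_i +
  -- e_j` forces that entry to be nonnegative.
  have h1 := hlim _ (add_nonneg (hs i) (hs j)) (symmDiff T {i})
  rw [quad_single_add_single (hQ.flip _).symm, quad_single_add_single (hQ.flip _).symm] at h1
  simp only [flip_diag] at h1
  have hsi : sgn (symmDiff T {i}) i = -sgn T i := by
    by_cases hi : i ∈ T <;> simp [sgn, Finset.mem_symmDiff, hi]
  have hsj : sgn (symmDiff T {i}) j = sgn T j := by
    simp [sgn, Finset.mem_symmDiff, Ne.symm hij]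
  have h2 : flip Q (symmDiff T {i}) i j = -flip Q T i j := by
    rw [flip_apply, flip_apply, hsi, hsj]
    ring
  rw [h2] at h1
  linarith

theorem not_nonneg_of_not_C2 {Yh : Matrix (Fin n) (Fin k) ℝ} (hY : Function.Injective Yh.mulVec)
    (h : ¬ C2 Yh) : ¬ ∃ T, ∀ i j, 0 ≤ flip (Yhᵀ * Yh)⁻¹ T i j := fun ⟨T, hT⟩ =>
  h ⟨T, ((isPD_gram hY).inv.flip T).posSemidef, hT⟩

/-- Necessity of `C2` in width `k - 1`; it needs no assumption on the Pareto front. -/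
theorem necessaryForExploration_C2 {p : ℕ} {X : Matrix (Fin n) (Fin p) ℝ}
    {Y : Matrix (Fin n) (Fin k) ℝ} (hk : 1 ≤ k)
    (hY : Function.Injective (optPred X Y).mulVec) :
    NecessaryForExploration X Y (k - 1) (surfI (optPred X Y)) (formI (optPred X Y))
      (C2 (optPred X Y)) := by
  have key : ¬ C2 (optPred X Y) → ∃ T T' v,
      IsIntersectionPoint (paretoFront (optPred X Y) (k - 1)) (surfI (optPred X Y)) T T' v ∧
      GradientsDisagree (formI (optPred X Y) T) (formI (optPred X Y) T') v ∧
      sqNorms Y - v ∈ lossFront X Y (k - 1) ∧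
      ¬ ReachedByScalarization X Y (k - 1) (sqNorms Y - v) := by
    intro hC
    have hQ := (isPD_gram hY).inv
    obtain ⟨T, T', x, hx, htie, hmax, hne⟩ :=
      exists_tie_of_not_nonneg hQ (not_nonneg_of_not_C2 hY hC)
    have hx0 : x ≠ 0 := fun h => by
      have := hx ⟨0, hk⟩
      rw [h] at this
      exact lt_irrefl _ this
    have hpos := (hQ.flip T).pos x hx0
    have hT1 := (hQ.flip T).quad_normalize hx0
    set c := (√(quad (flip ((optPred X Y)ᵀ * optPred X Y)⁻¹ T) x))⁻¹ with hc
    have hcpos : 0 < c := inv_pos.2 (Real.sqrt_pos.2 hpos)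
    have hcx : ∀ i, 0 < (c • x) i := fun i => mul_pos hcpos (hx i)
    refine witness_surfI rfl hk hY (T := T) (T' := T') hcx hT1 ?_ ?_
      (sub_sq_mem_paretoFront_pred hk hY (fun i => (hcx i).le) hT1 fun T'' => ?_)
    · rw [quad_smul, ← htie, ← quad_smul, hT1]
    · rw [Matrix.mulVec_smul, Matrix.mulVec_smul]
      exact fun h => hne (smul_right_injective _ hcpos.ne' h)
    · rw [← hT1, quad_smul, quad_smul]
      exact mul_le_mul_of_nonneg_left (hmax T'') (sq_nonneg c)
  refine ⟨fun hF => ?_, key⟩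
  by_contra hC
  obtain ⟨T, T', v, -, -, hv, hn⟩ := key hC
  exact hn (hF _ hv)

end WidthPred

/-! ### Width `1` -/

section WidthOne

open Matrix

variable {n k : ℕ}

/-- A nonzero point of the sublevel set can be scaled outwards to the level set, which only
increases its squares; so competitors may be taken from the whole ellipsoid. -/
theorem sq_mem_paretoFront_one_iff {Yh : Matrix (Fin n) (Fin k) ℝ}
    (hY : Function.Injective Yh.mulVec) {T : Finset (Fin k)} {x : Fin k → ℝ}
    (hx : quad (flip (Yhᵀ * Yh)⁻¹ T) x = 1) :
    x ^ 2 ∈ paretoFront Yh 1 ↔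
      ∀ u, quad (Yhᵀ * Yh)⁻¹ u ≤ 1 → x ^ 2 ≤ u ^ 2 → u ^ 2 = x ^ 2 := by
  have hQ := (isPD_gram hY).inv
  constructor
  · intro h u hu hxu
    have hu0 : u ≠ 0 := by
      rintro rfl
      have : x = 0 := funext fun i => by
        have h1 := hxu i
        simp only [Pi.pow_apply, Pi.zero_apply] at h1 ⊢
        nlinarith [sq_nonneg (x i)]
      rw [this] at hx
      simp [quad] at hx
    have hp := hQ.pos u hu0
    set q := quad (Yhᵀ * Yh)⁻¹ u with hq
    set w := (√q)⁻¹ • u with hw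
    have hw2 : ∀ i, (w ^ 2) i = q⁻¹ * u i ^ 2 := fun i => by
      rw [hw, Pi.pow_apply, Pi.smul_apply, smul_eq_mul, mul_pow, inv_pow, Real.sq_sqrt hp.le]
    have huw : ∀ i, (u ^ 2) i ≤ (w ^ 2) i := fun i => by
      rw [hw2]
      exact le_mul_of_one_le_left (sq_nonneg _) ((one_le_inv₀ hp).2 hu)
    have h1 := h.2 ((mem_feasibleRegion_one hY _).2 ⟨w, hQ.quad_normalize hu0, rfl⟩)
      (fun i => (hxu i).trans (huw i))
    exact le_antisymm (fun i => (huw i).trans (h1 i)) hxu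
  · intro h
    refine ⟨(mem_feasibleRegion_one hY _).2 ⟨sgn T * x, by rwa [← quad_flip],
      (funext fun i => sgn_mul_sq T x i).symm⟩, fun v hv hle => ?_⟩
    obtain ⟨u, hu, rfl⟩ := (mem_feasibleRegion_one hY _).1 hv
    exact (h u hu.le hle).le

/-- At a Pareto optimal point, the gradient vanishes in the directions of the zero coordinates. -/
theorem mulVec_eq_zero_of_mem_paretoFront {Yh : Matrix (Fin n) (Fin k) ℝ}
    (hY : Function.Injective Yh.mulVec) {T : Finset (Fin k)} {x : Fin k → ℝ}
    (hx : quad (flip (Yhᵀ * Yh)⁻¹ T) x = 1) (hPF : x ^ 2 ∈ paretoFront Yh 1) {i : Fin k}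
    (hi : x i = 0) : (flip (Yhᵀ * Yh)⁻¹ T *ᵥ x) i = 0 := by
  have hM := (isPD_gram hY).inv.flip T
  rw [sq_mem_paretoFront_one_iff hY hx] at hPF
  set M := flip (Yhᵀ * Yh)⁻¹ T with hMd
  set b := (M *ᵥ x) i with hb
  have hd := hM.diag_pos i
  have hsq : ∀ y : Fin k → ℝ, (sgn T * y) ^ 2 = y ^ 2 := fun y =>
    funext fun i => sgn_mul_sq T y i
  -- Since `x i = 0`, any change of this coordinate keeps domination. The chosen one minimizes the
  -- form along `e_i`, lowering it by `b ^ 2 / M i i`, and optimality forbids any change.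
  have h := hPF (sgn T * (x + Pi.single i (-b / M i i))) ?_ ?_
  · have h1 := congrFun h i
    rw [hsq, Pi.pow_apply, Pi.pow_apply, Pi.add_apply, Pi.single_eq_same, hi, zero_add,
      zero_pow two_ne_zero, sq_eq_zero_iff, div_eq_zero_iff, neg_eq_zero] at h1
    exact h1.resolve_right hd.ne'
  · rw [← quad_flip, quad_add_single hM.symm, hx, ← hb]
    have : 1 + 2 * (-b / M i i) * b + (-b / M i i) ^ 2 * M i i = 1 - b ^ 2 / M i i := by
      field_simp
      ring
    rw [this]
    have : 0 ≤ b ^ 2 / M i i := by positivity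
    linarith
  · rw [hsq]
    intro j
    rw [Pi.pow_apply, Pi.pow_apply, Pi.add_apply]
    by_cases hj : j = i
    · subst hj
      rw [hi, zero_pow two_ne_zero]
      positivity
    · rw [Pi.single_eq_of_ne hj, add_zero]

/-- A relative interior intersection point of the Pareto front can be moved to one with positive
coordinates where the gradients disagree. -/
theorem exists_positive_of_relInterior {Yh : Matrix (Fin n) (Fin k) ℝ}
    (hY : Function.Injective Yh.mulVec) {T T' : Finset (Fin k)} {v : Fin k → ℝ}
    (hint : IsIntersectionPoint (paretoFront Yh 1) (surfE Yh) T T' v)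
    (hev : ∀ᶠ w in 𝓝[surfE Yh T ∩ surfE Yh T'] v, w ∈ paretoFront Yh 1) :
    ∃ x, (∀ i, 0 < x i) ∧ quad (flip (Yhᵀ * Yh)⁻¹ T) x = 1 ∧
      quad (flip (Yhᵀ * Yh)⁻¹ T') x = 1 ∧
      flip (Yhᵀ * Yh)⁻¹ T *ᵥ x ≠ flip (Yhᵀ * Yh)⁻¹ T' *ᵥ x ∧ x ^ 2 ∈ paretoFront Yh 1 := by
  have hQ := (isPD_gram hY).inv
  obtain ⟨-, hS, hvT, hvT'⟩ := hint
  have hne := flip_ne_of_surfE_ne hS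
  obtain ⟨x₀, hx₀, hx₀T, rfl⟩ := (mem_surfE_iff _ _ _).1 hvT
  rw [sq_mem_surfE_iff Yh T' hx₀] at hvT'
  have hM := hQ.flip T
  have hM' := hQ.flip T'
  set M := flip (Yhᵀ * Yh)⁻¹ T with hMd
  set M' := flip (Yhᵀ * Yh)⁻¹ T' with hMd'
  -- After normalization, the common points of the two surfaces are the nonnegative zeros of `quad
  -- D`. Flips preserve the diagonal, so `D` has zero diagonal and `quad D` is affine in each
  -- coordinate.
  set D := M - M' with hD
  have hDsymm : D.IsSymm := hM.symm.sub hM'.symm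
  have hDdiag : ∀ i, D i i = 0 := fun i => by
    rw [hD, Matrix.sub_apply, hMd, hMd', flip_diag, flip_diag, sub_self]
  have hDquad : ∀ y, quad D y = quad M y - quad M' y := fun y => by
    rw [quad, hD, Matrix.sub_mulVec, dotProduct_sub]
    rfl
  have hDmul : ∀ y, D *ᵥ y = M *ᵥ y - M' *ᵥ y := fun y => Matrix.sub_mulVec _ _ _
  let nrm : (Fin k → ℝ) → Fin k → ℝ := fun y => (√(quad M y))⁻¹ • y
  have hx₀0 : x₀ ≠ 0 := by
    rintro rfl
    simp [quad] at hx₀T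
  have hnpos : ∀ y : Fin k → ℝ, y ≠ 0 → 0 < (√(quad M y))⁻¹ := fun y hy =>
    inv_pos.2 (Real.sqrt_pos.2 (hM.pos y hy))
  have hnM : ∀ y, y ≠ 0 → quad M (nrm y) = 1 := fun y hy => hM.quad_normalize hy
  have hnM' : ∀ y, y ≠ 0 → quad D y = 0 → quad M' (nrm y) = 1 := fun y hy h => by
    have h1 := hnM y hy
    have h2 : quad D (nrm y) = 0 := by rw [quad_smul, h, mul_zero]
    rw [hDquad] at h2
    linarith
  have hN : ∀ᶠ y in 𝓝 x₀, y ≠ 0 ∧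
      (0 ≤ y → quad D y = 0 → nrm y ^ 2 ∈ paretoFront Yh 1) := by
    have hcont : ContinuousAt (fun y => nrm y ^ 2) x₀ := by
      have h1 : ContinuousAt (fun y => (√(quad M y))⁻¹) x₀ :=
        (continuous_quad M).continuousAt.sqrt.inv₀ (by rw [hx₀T]; simp)
      exact (h1.smul continuousAt_id).pow 2
    have hval : nrm x₀ ^ 2 = x₀ ^ 2 := by simp [nrm, hx₀T]
    have hev' := eventually_nhdsWithin_iff.1 hev
    rw [← hval] at hev'
    have h2 := hcont.eventually hev'
    filter_upwards [h2, isOpen_ne.mem_nhds hx₀0] with y hy hy0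
    refine ⟨hy0, fun hpos hq => hy ?_⟩
    have hn0 : 0 ≤ nrm y := smul_nonneg (hnpos y hy0).le hpos
    exact ⟨(sq_mem_surfE_iff Yh T hn0).2 (hnM y hy0),
      (sq_mem_surfE_iff Yh T' hn0).2 (hnM' y hy0 hq)⟩
  have hx₀D : quad D x₀ = 0 := by rw [hDquad, hx₀T, hvT', sub_self]
  have hstep : ∃ x₁, (∀ᶠ y in 𝓝 x₁, y ≠ 0 ∧
      (0 ≤ y → quad D y = 0 → nrm y ^ 2 ∈ paretoFront Yh 1)) ∧ 0 ≤ x₁ ∧ quad D x₁ = 0 ∧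
      D *ᵥ x₁ ≠ 0 := by
    -- If the gradients agree at `x₀`, a small move along `e_i` with `D e_i ≠ 0` keeps `quad D = 0`
    -- and separates them.
    by_cases h0 : D *ᵥ x₀ = 0
    · have hex : ∃ i, D *ᵥ Pi.single i 1 ≠ 0 := by
        by_contra hcon
        push Not at hcon
        apply sub_ne_zero.2 hne
        apply Matrix.ext_of_mulVec_single
        intro i
        rw [hcon i, Matrix.zero_mulVec]
      obtain ⟨i, hi⟩ := hex
      have hc : Continuous fun e : ℝ => x₀ + Pi.single i e := by
        refine continuous_const.add ?_
        exact continuous_single (A := fun _ : Fin k => ℝ) i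
      have ht : Filter.Tendsto (fun e : ℝ => x₀ + Pi.single i e) (𝓝[>] 0) (𝓝 x₀) := by
        have := (hc.tendsto 0).mono_left (nhdsWithin_le_nhds (s := Set.Ioi 0))
        simpa using this
      obtain ⟨e, he, hepos⟩ := ((ht.eventually (eventually_eventually_nhds.2 hN)).and
        (self_mem_nhdsWithin (s := Set.Ioi (0 : ℝ)))).exists
      refine ⟨_, he, add_nonneg hx₀ (Pi.single_nonneg.2 (le_of_lt hepos)), ?_, ?_⟩
      · rw [quad_add_single hDsymm, hx₀D, h0, hDdiag]
        simp
      · have hs : (Pi.single i e : Fin k → ℝ) = e • Pi.single i 1 := by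
          rw [← Pi.single_smul, smul_eq_mul, mul_one]
        rw [Matrix.mulVec_add, h0, zero_add, hs, Matrix.mulVec_smul]
        exact smul_ne_zero (ne_of_gt hepos) hi
    · exact ⟨x₀, hN, hx₀, hx₀D, h0⟩
  obtain ⟨x₁, hN₁, hx₁, hx₁D, hx₁ne⟩ := hstep
  obtain ⟨j, hj⟩ := Function.ne_iff.1 hx₁ne
  rw [Pi.zero_apply] at hj
  obtain ⟨hx₁0, hx₁PF⟩ := hN₁.self_of_nhds
  -- At a zero coordinate of an optimal point both gradient entries vanish, so they cannot differ
  -- there.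
  have hx₁j : 0 < x₁ j := by
    refine lt_of_le_of_ne (hx₁ j) fun h => hj ?_
    have hnj : nrm x₁ j = 0 := by
      rw [show nrm x₁ j = (√(quad M x₁))⁻¹ * x₁ j from rfl, ← h]
      exact mul_zero _
    have hPF := hx₁PF hx₁ hx₁D
    have h1 := mulVec_eq_zero_of_mem_paretoFront hY (hnM x₁ hx₁0) hPF hnj
    have h2 := mulVec_eq_zero_of_mem_paretoFront hY (hnM' x₁ hx₁0 hx₁D) hPF hnj
    have h3 : (D *ᵥ nrm x₁) j = 0 := by rw [hDmul, Pi.sub_apply, h1, h2, sub_zero]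
    rw [Matrix.mulVec_smul, Pi.smul_apply, smul_eq_mul] at h3
    exact (mul_eq_zero.1 h3).resolve_left (hnpos x₁ hx₁0).ne'
  let y : ℝ → Fin k → ℝ := fun e => x₁ + e • (1 : Fin k → ℝ)
  have hyc : Continuous y := by fun_prop
  have hy0 : y 0 = x₁ := by simp [y]
  -- All coordinates are raised by `e`, and coordinate `j` is then corrected by the root `δ e` of an
  -- affine function to return to `quad D = 0`. It stays positive for small `e`, and the correction
  -- does not change `(D *ᵥ y e) j`.
  let δ : ℝ → ℝ := fun e => -quad D (y e) / (2 * (D *ᵥ y e) j)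
  let z : ℝ → Fin k → ℝ := fun e => y e + Pi.single j (δ e)
  have hgc : Continuous fun e => (D *ᵥ y e) j := (continuous_mulVec_apply D j).comp hyc
  have hδc : ContinuousAt δ 0 := by
    refine ((continuous_quad D).comp hyc).neg.continuousAt.div
      (continuous_const.mul hgc).continuousAt ?_
    rw [hy0]
    exact mul_ne_zero two_ne_zero hj
  have hzc : ContinuousAt z 0 := hyc.continuousAt.add
    ((continuous_single (A := fun _ : Fin k => ℝ) j).continuousAt.comp hδc)
  have hz0 : z 0 = x₁ := by simp [z, δ, hy0, hx₁D]
  have hE1 : ∀ᶠ e in 𝓝[>] (0 : ℝ), z e ≠ 0 ∧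
      (0 ≤ z e → quad D (z e) = 0 → nrm (z e) ^ 2 ∈ paretoFront Yh 1) :=
    (hzc.eventually (by rwa [hz0])).filter_mono nhdsWithin_le_nhds
  have hE2 : ∀ᶠ e in 𝓝[>] (0 : ℝ), (D *ᵥ y e) j ≠ 0 :=
    (hgc.continuousAt.eventually_ne (by rwa [hy0])).filter_mono nhdsWithin_le_nhds
  have hE3 : ∀ᶠ e in 𝓝[>] (0 : ℝ), 0 < z e j := by
    have h1 : ContinuousAt (fun e => z e j) 0 := (continuous_apply j).continuousAt.comp hzc
    have h2 : 0 < z 0 j := by rwa [hz0]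
    exact (h1.eventually (lt_mem_nhds h2)).filter_mono nhdsWithin_le_nhds
  obtain ⟨e, ⟨hz, hPF⟩, hg, hzj, he⟩ := (hE1.and (hE2.and (hE3.and
    (self_mem_nhdsWithin (s := Set.Ioi (0 : ℝ)))))).exists
  have hzpos : ∀ i, 0 < z e i := fun i => by
    by_cases hi : i = j
    · rwa [hi]
    · have : z e i = x₁ i + e := by simp [z, y, Pi.single_eq_of_ne hi]
      rw [this]
      exact add_pos_of_nonneg_of_pos (hx₁ i) he
  have hzD : quad D (z e) = 0 := by
    rw [quad_add_single hDsymm, hDdiag]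
    simp only [δ]
    field_simp
    ring
  have hzg : (D *ᵥ z e) j ≠ 0 := by
    rw [Matrix.mulVec_add, Pi.add_apply, Matrix.mulVec_single, Pi.smul_apply, Matrix.col_apply,
      hDdiag, smul_zero, add_zero]
    exact hg
  refine ⟨nrm (z e), fun i => mul_pos (hnpos _ hz) (hzpos i), hnM _ hz, hnM' _ hz hzD, fun h => ?_,
    hPF (fun i => (hzpos i).le) hzD⟩
  have h1 : D *ᵥ nrm (z e) = 0 := by rw [hDmul, h, sub_self]
  rw [Matrix.mulVec_smul] at h1
  have h2 := congrFun h1 j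
  rw [Pi.smul_apply, smul_eq_mul, Pi.zero_apply] at h2
  exact hzg ((mul_eq_zero.1 h2).resolve_left (hnpos _ hz).ne')

/-- The column `G eᵢ / √Gᵢᵢ` is, up to sign, the only vector of the unit level set whose `i`-th
coordinate is that large. -/
theorem IsPD.eq_or_eq_neg_of_le_sq {G : Matrix (Fin k) (Fin k) ℝ} (hG : IsPD G) (i : Fin k)
    {u : Fin k → ℝ} (hu : quad G⁻¹ u ≤ 1) (hi : G i i ≤ u i ^ 2) :
    ∃ σ : ℝ, σ ^ 2 = 1 ∧ ∀ j, u j = σ * (G j i / √(G i i)) := by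
  have hd := hG.diag_pos i
  have hs := Real.sqrt_pos.2 hd
  have hs2 := Real.sq_sqrt hd.le
  obtain ⟨σ, hσ, hσu⟩ : ∃ σ : ℝ, σ ^ 2 = 1 ∧ σ * u i = |u i| := by
    rcases le_total 0 (u i) with h | h
    · exact ⟨1, one_pow 2, by rw [one_mul, abs_of_nonneg h]⟩
    · exact ⟨-1, by norm_num, by rw [neg_one_mul, abs_of_nonpos h]⟩
  have habs : √(G i i) ≤ |u i| := by
    rw [← Real.sqrt_sq_eq_abs]
    exact Real.sqrt_le_sqrt hi
  have hcol : G⁻¹ *ᵥ (G *ᵥ Pi.single i 1) = Pi.single i 1 := hG.inv_mulVec_mulVec _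
  set w := G *ᵥ Pi.single i (1 : ℝ) with hw
  -- The squared distance from `u` to the signed column, in the form of `G⁻¹`; the size of `u i`
  -- makes it nonpositive.
  have hquad : quad G⁻¹ (u + (-(σ / √(G i i))) • w) =
      quad G⁻¹ u - 2 * (|u i| / √(G i i)) + 1 := by
    rw [quad_add hG.inv.symm, quad_smul, smul_dotProduct,
      dotProduct_mulVec_symm hG.inv.symm, hcol, dotProduct_single_one, hw, hG.quad_inv_mulVec,
      quad_single, smul_eq_mul, ← hσu, neg_sq, div_pow, hσ, hs2]
    field_simp
    ring
  have h0 : u + (-(σ / √(G i i))) • w = 0 := by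
    refine hG.inv.eq_zero_of_quad_nonpos ?_
    rw [hquad]
    have : 1 ≤ |u i| / √(G i i) := (one_le_div hs).2 habs
    linarith
  refine ⟨σ, hσ, fun j => ?_⟩
  have h1 := congrFun h0 j
  rw [hw, Matrix.mulVec_single_one] at h1
  simp only [Pi.add_apply, Pi.smul_apply, smul_eq_mul, Matrix.col_apply, Pi.zero_apply] at h1
  linear_combination h1

/-- The normalized column of `G` has the largest possible `i`-th coordinate, and uniqueness up to
sign makes it optimal. -/
theorem exists_mem_paretoFront_one {Yh : Matrix (Fin n) (Fin k) ℝ}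
    (hY : Function.Injective Yh.mulVec) (i : Fin k) :
    ∃ v ∈ paretoFront Yh 1, v i = (Yhᵀ * Yh) i i := by
  have hG := isPD_gram hY
  have hd := hG.diag_pos i
  have hs2 := Real.sq_sqrt hd.le
  set G := Yhᵀ * Yh with hGd
  have huj : ∀ j, ((√(G i i))⁻¹ • G *ᵥ Pi.single i 1) j = G j i / √(G i i) := fun j => by
    rw [Pi.smul_apply, Matrix.mulVec_single_one, Matrix.col_apply, smul_eq_mul, div_eq_inv_mul]
  have hu : quad G⁻¹ ((√(G i i))⁻¹ • G *ᵥ Pi.single i 1) = 1 := by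
    rw [quad_smul, hG.quad_inv_mulVec, quad_single, inv_pow, hs2]
    field_simp
  set u := (√(G i i))⁻¹ • G *ᵥ Pi.single i (1 : ℝ) with hud
  have hui : u i ^ 2 = G i i := by
    rw [huj, div_pow, hs2]
    field_simp
  refine ⟨u ^ 2, ⟨(mem_feasibleRegion_one hY _).2 ⟨u, hu, rfl⟩, fun v hv hle => ?_⟩, hui⟩
  obtain ⟨w, hw, rfl⟩ := (mem_feasibleRegion_one hY _).1 hv
  obtain ⟨σ, hσ, hwj⟩ := hG.eq_or_eq_neg_of_le_sq i hw.le (hui.ge.trans (hle i))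
  intro j
  rw [Pi.pow_apply, Pi.pow_apply, hwj, huj, mul_pow, hσ, one_mul]

/-- If the Pareto front lies on one surface, then `C1` holds. -/
theorem C1_of_paretoFront_subset {Yh : Matrix (Fin n) (Fin k) ℝ}
    (hY : Function.Injective Yh.mulVec) {T : Finset (Fin k)}
    (h : paretoFront Yh 1 ⊆ surfE Yh T) : C1 Yh := by
  have hG := isPD_gram hY
  have hGT : Gmat Yh T = flip (Yhᵀ * Yh) T := by
    have : Gmat Yh T = (flip (Yhᵀ * Yh)⁻¹ T)⁻¹ := rfl
    rw [this, flip_inv, Matrix.nonsing_inv_nonsing_inv _ hG.isUnit_det]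
  refine ⟨T, ?_, fun j i => ?_⟩
  · rw [hGT]
    exact (hG.flip T).posSemidef
  obtain ⟨v, hv, hvi⟩ := exists_mem_paretoFront_one hY i
  obtain ⟨x, hx, hxT, rfl⟩ := (mem_surfE_iff _ _ _).1 (h hv)
  rw [quad_flip] at hxT
  obtain ⟨σ, hσ, hu⟩ := hG.eq_or_eq_neg_of_le_sq i hxT.le (by rw [sgn_mul_sq]; exact hvi.ge)
  have hd := hG.diag_pos i
  have hs := Real.sqrt_pos.2 hd
  rw [hGT, flip_apply]
  have key : ∀ j, sgn T j * (Yhᵀ * Yh) j i * σ = x j * √((Yhᵀ * Yh) i i) := fun j => by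
    have h1 := hu j
    rw [Pi.mul_apply] at h1
    have h2 := sgn_mul_self T j
    field_simp at h1
    linear_combination (-sgn T j) * h1 + x j * √((Yhᵀ * Yh) i i) * h2
  -- The diagonal entry fixes the global sign: `x i` and `G i i` are nonnegative, so `σ` is the sign
  -- of `i` in `T`.
  have hi : sgn T i * σ = 1 := by
    have h1 := key i
    have h2 : 0 ≤ sgn T i * σ := by
      have h3 : 0 ≤ (sgn T i * σ) * (Yhᵀ * Yh) i i := by
        have := mul_nonneg (hx i) hs.le
        linarith
      exact nonneg_of_mul_nonneg_left h3 hd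
    have h3 : (sgn T i * σ) ^ 2 = 1 := by rw [mul_pow, sgn_sq, hσ, one_mul]
    nlinarith
  have hσi : σ = sgn T i := by
    have h2 := sgn_mul_self T i
    linear_combination sgn T i * hi - σ * h2
  rw [← hσi, key]
  exact mul_nonneg (hx j) hs.le

theorem isClosed_surfE (Yh : Matrix (Fin n) (Fin k) ℝ) (T : Finset (Fin k)) :
    IsClosed (surfE Yh T) := by
  have hc : Continuous (formE Yh T) := by
    have : formE Yh T = quad (Qmat Yh T) ∘ fun (v : Fin k → ℝ) i => √(v i) := rfl
    rw [this]
    exact (continuous_quad _).comp (by fun_prop)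
  have : surfE Yh T = {v | 0 ≤ v} ∩ {v | formE Yh T v = 1} := rfl
  rw [this]
  exact isClosed_Ici.inter (isClosed_eq hc continuous_const)

/-- A connected Pareto front without intersection points lies on one surface. -/
theorem exists_intersectionPoint {Yh : Matrix (Fin n) (Fin k) ℝ}
    (hY : Function.Injective Yh.mulVec) (hc : IsPathConnected (paretoFront Yh 1)) (hC : ¬ C1 Yh) :
    ∃ T T' v, IsIntersectionPoint (paretoFront Yh 1) (surfE Yh) T T' v := by
  by_contra hcon
  push Not at hcon
  have hmem : ∀ v ∈ paretoFront Yh 1, ∃ T, v ∈ surfE Yh T := fun v hv => by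
    obtain ⟨u, hu, rfl⟩ := (mem_feasibleRegion_one hY _).1 hv.1
    obtain ⟨T, hT⟩ := exists_eq_sgn_mul_abs u
    refine ⟨T, (mem_surfE_iff _ _ _).2 ⟨fun i => |u i|, fun i => abs_nonneg _, ?_, ?_⟩⟩
    · rwa [quad_flip, ← hT]
    · exact funext fun i => (sq_abs (u i)).symm
  obtain ⟨v₀, hv₀⟩ := hc.nonempty
  obtain ⟨T, hT⟩ := hmem v₀ hv₀
  apply hC
  apply C1_of_paretoFront_subset (T := T) hY
  intro v hv
  by_contra hvT
  -- Surfaces are compared as sets, not by index, because complementary sign sets give the same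
  -- surface. Connectedness then yields a point common to `E_T` and a different surface.
  have hclosed : IsClosed (⋃ T' ∈ {T' | surfE Yh T ≠ surfE Yh T'}, surfE Yh T') :=
    (Set.toFinite _).isClosed_biUnion fun T' _ => isClosed_surfE Yh T'
  have hcover : paretoFront Yh 1 ⊆
      surfE Yh T ∪ ⋃ T' ∈ {T' | surfE Yh T ≠ surfE Yh T'}, surfE Yh T' := fun w hw => by
    obtain ⟨T', hT'⟩ := hmem w hw
    by_cases he : surfE Yh T = surfE Yh T'
    · exact Or.inl (he ▸ hT')
    · exact Or.inr (Set.mem_biUnion (show T' ∈ {T' | surfE Yh T ≠ surfE Yh T'} from he) hT')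
  obtain ⟨w, hw, hwT, hwU⟩ := isPreconnected_closed_iff.1 hc.isConnected.isPreconnected _ _
    (isClosed_surfE Yh T) hclosed hcover ⟨v₀, hv₀, hT⟩
    ⟨v, hv, (hcover hv).resolve_left hvT⟩
  obtain ⟨T', hT', hwT'⟩ := Set.mem_iUnion₂.1 hwU
  exact hcon T T' w ⟨hw, hT', hwT, hwT'⟩

/-- It suffices to find a Pareto optimal point with positive coordinates and gradient
disagreement. -/
theorem necessaryForExploration_C1_of {p : ℕ} {X : Matrix (Fin n) (Fin p) ℝ}
    {Y : Matrix (Fin n) (Fin k) ℝ} {Yh : Matrix (Fin n) (Fin k) ℝ} (hYh : Yh = optPred X Y)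
    (hk : 1 ≤ k) (hY : Function.Injective Yh.mulVec)
    (h : ¬ C1 Yh → ∃ T T' x, (∀ i, 0 < x i) ∧ quad (flip (Yhᵀ * Yh)⁻¹ T) x = 1 ∧
      quad (flip (Yhᵀ * Yh)⁻¹ T') x = 1 ∧
      flip (Yhᵀ * Yh)⁻¹ T *ᵥ x ≠ flip (Yhᵀ * Yh)⁻¹ T' *ᵥ x ∧ x ^ 2 ∈ paretoFront Yh 1) :
    NecessaryForExploration X Y 1 (surfE (optPred X Y)) (formE (optPred X Y))
      (C1 (optPred X Y)) := by
  have key : ¬ C1 (optPred X Y) → ∃ T T' v,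
      IsIntersectionPoint (paretoFront (optPred X Y) 1) (surfE (optPred X Y)) T T' v ∧
      GradientsDisagree (formE (optPred X Y) T) (formE (optPred X Y) T') v ∧
      sqNorms Y - v ∈ lossFront X Y 1 ∧ ¬ ReachedByScalarization X Y 1 (sqNorms Y - v) := by
    intro hC
    rw [← hYh] at hC
    obtain ⟨T, T', x, hx, hT, hT', hne, hPF⟩ := h hC
    exact witness_surfE hYh hk hY hx hT hT' hne hPF
  refine ⟨fun hF => ?_, key⟩
  by_contra hC
  obtain ⟨T, T', v, -, -, hv, hn⟩ := key hC
  exact hn (hF _ hv)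

end WidthOne

/-! ### Three tasks, width `1` -/

section Three

open Matrix

variable {n : ℕ}

theorem sgn_symmDiff {k : ℕ} (T S : Finset (Fin k)) (i : Fin k) :
    sgn (symmDiff T S) i = sgn T i * sgn S i := by
  by_cases h1 : i ∈ T <;> by_cases h2 : i ∈ S <;> simp [sgn, Finset.mem_symmDiff, h1, h2]

theorem flip_symmDiff {k : ℕ} (Q : Matrix (Fin k) (Fin k) ℝ) (T S : Finset (Fin k)) :
    flip Q (symmDiff T S) = flip (flip Q T) S := by
  ext i j
  simp only [flip_apply, sgn_symmDiff]
  ring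

theorem IsPD.det_pos {k : ℕ} {Q : Matrix (Fin k) (Fin k) ℝ} (hQ : IsPD Q) : 0 < Q.det :=
  lt_of_le_of_ne hQ.posSemidef.det_nonneg hQ.isUnit_det.ne_zero.symm

/-- If `C1` fails for three tasks, some sign pattern makes all off-diagonal entries of the Gram
matrix negative. -/
theorem exists_flip_neg_of_not_nonneg {G : Matrix (Fin 3) (Fin 3) ℝ} (hG : IsPD G)
    (h : ¬ ∃ T, ∀ i j, 0 ≤ flip G T i j) :
    ∃ T, flip G T 0 1 < 0 ∧ flip G T 0 2 < 0 ∧ flip G T 1 2 < 0 := by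
  have hd : ∀ i, 0 ≤ G i i := fun i => (hG.diag_pos i).le
  have hsub : ∀ T, ¬ (0 ≤ flip G T 0 1 ∧ 0 ≤ flip G T 0 2 ∧ 0 ≤ flip G T 1 2) := fun T hT => by
    have hs := (hG.flip T).symm
    refine h ⟨T, fun i j => ?_⟩
    fin_cases i <;> fin_cases j
    · exact (flip_diag G T 0).symm ▸ hd 0
    · exact hT.1
    · exact hT.2.1
    · exact hs.apply 0 1 ▸ hT.1
    · exact (flip_diag G T 1).symm ▸ hd 1
    · exact hT.2.2
    · exact hs.apply 0 2 ▸ hT.2.1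
    · exact hs.apply 1 2 ▸ hT.2.2
    · exact (flip_diag G T 2).symm ▸ hd 2
  -- Up to complement these are all the sign sets. A flip of one index negates two of the three
  -- off-diagonal entries, so the sign of their product is invariant and must be negative here.
  have h0 := hsub ∅
  have h1 := hsub {0}
  have h2 := hsub {1}
  have h3 := hsub {2}
  have goal : ∀ T, (flip G T 0 1 < 0 ∧ flip G T 0 2 < 0 ∧ flip G T 1 2 < 0) →
    ∃ T, flip G T 0 1 < 0 ∧ flip G T 0 2 < 0 ∧ flip G T 1 2 < 0 := fun T h => ⟨T, h⟩
  have g0 := goal ∅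
  have g1 := goal {0}
  have g2 := goal {1}
  have g3 := goal {2}
  by_contra hcon
  replace g0 := mt g0 hcon
  replace g1 := mt g1 hcon
  replace g2 := mt g2 hcon
  replace g3 := mt g3 hcon
  simp [flip_apply, sgn] at h0 h1 h2 h3 g0 g1 g2 g3
  grind

/-- The inequality behind Pareto optimality of the tie: the form is larger at every point that
dominates `(a, b, z)`. -/
theorem sq_eq_of_dominates_tie {A B C a b c z p q r : ℝ} (ha : 0 < a) (hb : 0 < b) (hz : 0 < z)
    (hC : 0 < C)
    (hpd : ∀ p q r : ℝ, A * p ^ 2 + B * q ^ 2 + C * r ^ 2 + 2 * c * (p * q) + 2 * b * (p * r) +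
      2 * a * (q * r) ≤ 0 → p = 0 ∧ q = 0 ∧ r = 0)
    (hAC : 0 < C * A - b ^ 2) (hBC : 0 < C * B - a ^ 2)
    (h0 : 0 ≤ A * a - b * c - b * z) (h1 : 0 ≤ B * b - a * c - a * z)
    (h2 : C ^ 2 * z ^ 2 < 4 * (a * b) * (C * c - a * b))
    (hp : a ^ 2 ≤ p ^ 2) (hq : b ^ 2 ≤ q ^ 2) (hr : z ^ 2 ≤ r ^ 2)
    (h : A * p ^ 2 + B * q ^ 2 + C * r ^ 2 + 2 * c * (p * q) + 2 * b * (p * r) +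
      2 * a * (q * r) ≤ A * a ^ 2 + B * b ^ 2 + C * z ^ 2 - 2 * (a * b * c)) :
    p ^ 2 = a ^ 2 ∧ q ^ 2 = b ^ 2 ∧ r ^ 2 = z ^ 2 := by
  have hCc : 0 < C * c - a * b := by
    by_contra hneg
    have : 4 * (a * b) * (C * c - a * b) ≤ 0 :=
      mul_nonpos_of_nonneg_of_nonpos (by positivity) (not_lt.1 hneg)
    nlinarith [sq_nonneg (C * z)]
  wlog hp0 : 0 ≤ p generalizing p q r with H
  · have := H (p := -p) (q := -q) (r := -r) (by rwa [neg_sq]) (by rwa [neg_sq]) (by rwa [neg_sq])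
      (by convert h using 1; ring) (by linarith)
    simpa only [neg_sq] using this
  have hpa : a ≤ p := abs_le_of_sq_le_sq' hp hp0 |>.2
  rcases le_total 0 q with hq0 | hq0
  · have hqb : b ≤ q := abs_le_of_sq_le_sq' hq hq0 |>.2
    exfalso
    -- With `p` and `q` of equal sign, `C` times the form is completed to a square in `r`. What
    -- remains exceeds the tie value by at least `4ab(Cc - ab) - C²z²`, positive by `h2`.
    have e1 : (C * A - b ^ 2) * a ^ 2 ≤ (C * A - b ^ 2) * p ^ 2 :=
      mul_le_mul_of_nonneg_left hp hAC.le
    have e2 : (C * B - a ^ 2) * b ^ 2 ≤ (C * B - a ^ 2) * q ^ 2 :=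
      mul_le_mul_of_nonneg_left hq hBC.le
    have e3 : (C * c - a * b) * (a * b) ≤ (C * c - a * b) * (p * q) :=
      mul_le_mul_of_nonneg_left (mul_le_mul hpa hqb hb.le hp0) hCc.le
    have e4 := sq_nonneg (C * r + b * p + a * q)
    have e5 := mul_le_mul_of_nonneg_left h hC.le
    nlinarith
  · have hqb : b ≤ -q := abs_le_of_sq_le_sq' (by rwa [neg_sq]) (neg_nonneg.2 hq0) |>.2
    rcases le_total 0 r with hr0 | hr0
    · have hrz : z ≤ r := abs_le_of_sq_le_sq' hr hr0 |>.2
      -- The form is expanded at `(a, -b, z)`: the linear terms point outwards and are nonnegative,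
      -- so the form of the difference is nonpositive and the difference is zero. The other sign of
      -- `r` is treated at `(a, -b, -z)`.
      have e0 : 0 ≤ (p - a) * (A * a - b * c + b * z) :=
        mul_nonneg (sub_nonneg.2 hpa) (by nlinarith [mul_pos hb hz])
      have e1 : 0 ≤ (-q - b) * (B * b - a * c - a * z) := mul_nonneg (sub_nonneg.2 hqb) h1
      have e2 : 0 ≤ (r - z) * (C * z) := mul_nonneg (sub_nonneg.2 hrz) (by positivity)
      obtain ⟨k0, k1, k2⟩ := hpd (p - a) (q + b) (r - z) (by nlinarith)
      have f0 : p = a := by linarith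
      have f1 : q = -b := by linarith
      have f2 : r = z := by linarith
      rw [f0, f1, f2, neg_sq]
      exact ⟨rfl, rfl, rfl⟩
    · have hrz : z ≤ -r := abs_le_of_sq_le_sq' (by rwa [neg_sq]) (neg_nonneg.2 hr0) |>.2
      have e0 : 0 ≤ (p - a) * (A * a - b * c - b * z) := mul_nonneg (sub_nonneg.2 hpa) h0
      have e1 : 0 ≤ (-q - b) * (B * b - a * c + a * z) :=
        mul_nonneg (sub_nonneg.2 hqb) (by nlinarith [mul_pos ha hz])
      have e2 : 0 ≤ (-r - z) * (C * z) := mul_nonneg (sub_nonneg.2 hrz) (by positivity)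
      obtain ⟨k0, k1, k2⟩ := hpd (p - a) (q + b) (r + z) (by nlinarith)
      have f0 : p = a := by linarith
      have f1 : q = -b := by linarith
      have f2 : r = -z := by linarith
      rw [f0, f1, f2, neg_sq, neg_sq]
      exact ⟨rfl, rfl, rfl⟩

theorem quad_three {R : Matrix (Fin 3) (Fin 3) ℝ} (hR : R.IsSymm) (w : Fin 3 → ℝ) :
    quad R w = R 0 0 * w 0 ^ 2 + R 1 1 * w 1 ^ 2 + R 2 2 * w 2 ^ 2 + 2 * R 0 1 * (w 0 * w 1) +
      2 * R 0 2 * (w 0 * w 2) + 2 * R 1 2 * (w 1 * w 2) := by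
  simp only [quad, dotProduct, Matrix.mulVec, Fin.sum_univ_three]
  rw [hR.apply 0 1, hR.apply 0 2, hR.apply 1 2]
  ring

/-- The off-diagonal entries and `2 × 2` minors of a positive definite matrix whose inverse has
negative off-diagonal entries. -/
theorem IsPD.minors_three {R H : Matrix (Fin 3) (Fin 3) ℝ} (hR : IsPD R) (hH : IsPD H)
    (hRH : R⁻¹ = H) (hHR : H⁻¹ = R) (h01 : H 0 1 < 0) (h02 : H 0 2 < 0) (h12 : H 1 2 < 0) :
    0 < R 0 1 ∧ 0 < R 0 2 ∧ 0 < R 1 2 ∧ 0 < R 0 0 * R 1 2 - R 0 2 * R 0 1 ∧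
      0 < R 1 1 * R 0 2 - R 1 2 * R 0 1 ∧ 0 < R 2 2 * R 0 1 - R 1 2 * R 0 2 ∧
      0 < R 2 2 * R 0 0 - R 0 2 ^ 2 ∧ 0 < R 2 2 * R 1 1 - R 1 2 ^ 2 := by
  -- Adjugates of `R` and `H` relate the minors of each matrix to the entries of the other, so the
  -- signs in `H` determine all signs required of `R`.
  have hadj : ∀ {M N : Matrix (Fin 3) (Fin 3) ℝ}, IsPD M → M⁻¹ = N →
      ∀ i j, M.adjugate i j = M.det * N i j := fun {M N} hM hMN i j => by
    rw [← hMN, Matrix.inv_def, Ring.inverse_eq_inv', Matrix.smul_apply, smul_eq_mul,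
      mul_inv_cancel_left₀ hM.det_pos.ne']
  have hdR := hR.det_pos
  have hdH := hH.det_pos
  have aR := hadj hR hRH
  have aH := hadj hH hHR
  have sR : R 1 0 = R 0 1 ∧ R 2 0 = R 0 2 ∧ R 2 1 = R 1 2 :=
    ⟨hR.symm.apply 0 1, hR.symm.apply 0 2, hR.symm.apply 1 2⟩
  have sH : H 1 0 = H 0 1 ∧ H 2 0 = H 0 2 ∧ H 2 1 = H 1 2 :=
    ⟨hH.symm.apply 0 1, hH.symm.apply 0 2, hH.symm.apply 1 2⟩
  simp only [Matrix.adjugate_fin_three] at aR aH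
  have r01 := aR 0 1
  have r02 := aR 0 2
  have r12 := aR 1 2
  have r00 := aR 0 0
  have r11 := aR 1 1
  have q01 := aH 0 1
  have q02 := aH 0 2
  have q12 := aH 1 2
  simp [sR, sH] at r01 r02 r12 r00 r11 q01 q02 q12
  have d0 := hH.diag_pos 0
  have d1 := hH.diag_pos 1
  have d2 := hH.diag_pos 2
  refine ⟨?_, ?_, ?_, ?_, ?_, ?_, ?_, ?_⟩
  · refine (mul_pos_iff_of_pos_left hdH).1 ?_
    linarith [mul_pos_of_neg_of_neg h02 h12, mul_pos_of_neg_of_neg h01 (neg_neg_of_pos d2)]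
  · refine (mul_pos_iff_of_pos_left hdH).1 ?_
    linarith [mul_pos_of_neg_of_neg h01 h12, mul_pos_of_neg_of_neg h02 (neg_neg_of_pos d1)]
  · refine (mul_pos_iff_of_pos_left hdH).1 ?_
    linarith [mul_pos_of_neg_of_neg h01 h02, mul_pos_of_neg_of_neg h12 (neg_neg_of_pos d0)]
  · linarith [mul_pos_of_neg_of_neg h12 (neg_neg_of_pos hdR)]
  · linarith [mul_pos_of_neg_of_neg h02 (neg_neg_of_pos hdR)]
  · linarith [mul_pos_of_neg_of_neg h01 (neg_neg_of_pos hdR)]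
  · linarith [mul_pos hdR d1]
  · linarith [mul_pos hdR d0]

theorem exists_positive_three {Yh : Matrix (Fin n) (Fin 3) ℝ}
    (hY : Function.Injective Yh.mulVec) (hC : ¬ C1 Yh) :
    ∃ T T' x, (∀ i, 0 < x i) ∧ quad (flip (Yhᵀ * Yh)⁻¹ T) x = 1 ∧
      quad (flip (Yhᵀ * Yh)⁻¹ T') x = 1 ∧
      flip (Yhᵀ * Yh)⁻¹ T *ᵥ x ≠ flip (Yhᵀ * Yh)⁻¹ T' *ᵥ x ∧ x ^ 2 ∈ paretoFront Yh 1 := by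
  have hG := isPD_gram hY
  have hQ := hG.inv
  have hGmat : ∀ T, Gmat Yh T = flip (Yhᵀ * Yh) T := fun T => by
    have : Gmat Yh T = (flip (Yhᵀ * Yh)⁻¹ T)⁻¹ := rfl
    rw [this, flip_inv, Matrix.nonsing_inv_nonsing_inv _ hG.isUnit_det]
  obtain ⟨T₀, h01, h02, h12⟩ := exists_flip_neg_of_not_nonneg hG fun ⟨T, hT⟩ =>
    hC ⟨T, by rw [hGmat]; exact (hG.flip T).posSemidef, by rwa [hGmat]⟩
  have hR := hQ.flip T₀
  have hRH : (flip (Yhᵀ * Yh)⁻¹ T₀)⁻¹ = flip (Yhᵀ * Yh) T₀ := by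
    rw [flip_inv, Matrix.nonsing_inv_nonsing_inv _ hG.isUnit_det]
  obtain ⟨hc, hb, ha, m0, m1, m2, m3, m4⟩ :=
    hR.minors_three (hG.flip T₀) hRH (flip_inv _ _) h01 h02 h12
  have hsq := hR.diag_pos 2
  set R := flip (Yhᵀ * Yh)⁻¹ T₀ with hRdef
  -- At `z = 0` the three inequalities are strict, by the signs of the minors, so a small positive
  -- `z` satisfies them.
  obtain ⟨z, hz, hz0, hz1, hz2⟩ : ∃ z : ℝ, 0 < z ∧
      0 ≤ R 0 0 * R 1 2 - R 0 2 * R 0 1 - R 0 2 * z ∧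
      0 ≤ R 1 1 * R 0 2 - R 1 2 * R 0 1 - R 1 2 * z ∧
      R 2 2 ^ 2 * z ^ 2 < 4 * (R 1 2 * R 0 2) * (R 2 2 * R 0 1 - R 1 2 * R 0 2) := by
    have c0 : ContinuousAt (fun z : ℝ => R 0 0 * R 1 2 - R 0 2 * R 0 1 - R 0 2 * z) 0 := by fun_prop
    have c1 : ContinuousAt (fun z : ℝ => R 1 1 * R 0 2 - R 1 2 * R 0 1 - R 1 2 * z) 0 := by fun_prop
    have c2 : ContinuousAt (fun z : ℝ => R 2 2 ^ 2 * z ^ 2) 0 := by fun_prop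
    have e0 := c0.eventually (lt_mem_nhds (a := 0) (by simpa using m0))
    have e1 := c1.eventually (lt_mem_nhds (a := 0) (by simpa using m1))
    have e2 := c2.eventually_lt (continuousAt_const
      (y := 4 * (R 1 2 * R 0 2) * (R 2 2 * R 0 1 - R 1 2 * R 0 2))) (by
        rw [zero_pow two_ne_zero, mul_zero]
        positivity)
    obtain ⟨z, ⟨i0, i1, i2⟩, hz⟩ := (((e0.and (e1.and e2)).filter_mono nhdsWithin_le_nhds).and
      (self_mem_nhdsWithin (s := Set.Ioi (0 : ℝ)))).exists
    exact ⟨z, hz, i0.le, i1.le, i2⟩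
  have hf0 := (hR.flip {0}).symm
  have hf1 := (hR.flip {1}).symm
  -- The first two coordinates make the cross terms with `z` cancel for both flips, `{0}` and `{1}`,
  -- so the values tie; the gradients differ by `2 * R 0 2 * z` in coordinate `0`.
  let x : Fin 3 → ℝ := ![R 1 2, R 0 2, z]
  have hx : ∀ i, 0 < x i := fun i => by fin_cases i <;> assumption
  have hV0 : quad (flip R {0}) x = R 0 0 * R 1 2 ^ 2 + R 1 1 * R 0 2 ^ 2 + R 2 2 * z ^ 2 -
      2 * (R 1 2 * R 0 2 * R 0 1) := by
    rw [quad_three hf0]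
    simp [flip_apply, sgn, x]
    ring
  have hV1 : quad (flip R {1}) x = R 0 0 * R 1 2 ^ 2 + R 1 1 * R 0 2 ^ 2 + R 2 2 * z ^ 2 -
      2 * (R 1 2 * R 0 2 * R 0 1) := by
    rw [quad_three hf1]
    simp [flip_apply, sgn, x]
    ring
  have hx0 : x ≠ 0 := fun h => (hx 0).ne' (congrFun h 0)
  have hpos := (hR.flip {0}).pos x hx0
  have hn0 := (hR.flip {0}).quad_normalize hx0
  have hs2 := Real.sq_sqrt hpos.le
  have hspos := Real.sqrt_pos.2 hpos
  set s := √(quad (flip R {0}) x) with hs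
  have hcpos : 0 < s⁻¹ := inv_pos.2 hspos
  have hn1 : quad (flip R {1}) (s⁻¹ • x) = 1 := by
    rw [quad_smul, hV1, ← hV0, ← quad_smul, hn0]
  refine ⟨symmDiff T₀ {0}, symmDiff T₀ {1}, s⁻¹ • x, fun i => mul_pos hcpos (hx i), ?_⟩
  have hfl : ∀ S, flip (Yhᵀ * Yh)⁻¹ (symmDiff T₀ S) = flip R S := fun S => flip_symmDiff _ _ _
  rw [sq_mem_paretoFront_one_iff hY (T := symmDiff T₀ {0}) (by rw [hfl, hn0]), hfl, hfl]
  refine ⟨hn0, hn1, fun h => ?_, fun u hu hle => ?_⟩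
  · rw [Matrix.mulVec_smul, Matrix.mulVec_smul] at h
    have h1 := congrFun (smul_right_injective _ hcpos.ne' h) 0
    simp [Matrix.mulVec, dotProduct, Fin.sum_univ_three, flip_apply, sgn, x] at h1
    nlinarith [mul_pos hb hz]
  · set w := s • (sgn T₀ * u) with hw
    have hw2 : ∀ i, w i ^ 2 = s ^ 2 * u i ^ 2 := fun i => by
      rw [hw, Pi.smul_apply, smul_eq_mul, mul_pow, sgn_mul_sq]
    have hwx : ∀ i, x i ^ 2 ≤ w i ^ 2 := fun i => by
      have h1 := hle i
      rw [Pi.pow_apply, Pi.pow_apply, Pi.smul_apply, smul_eq_mul, mul_pow, inv_pow,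
        inv_mul_le_iff₀ (pow_pos hspos 2)] at h1
      rwa [hw2]
    have hqw : quad R w ≤ quad (flip R {0}) x := by
      rw [hw, quad_smul, hRdef, quad_flip, sgn_mul_sgn_mul, ← hRdef, hs2]
      exact mul_le_of_le_one_right hpos.le hu
    rw [hV0, quad_three hR.symm] at hqw
    obtain ⟨k0, k1, k2⟩ := sq_eq_of_dominates_tie ha hb hz hsq (fun p q r h => by
      have h1 := hR.eq_zero_of_quad_nonpos (u := ![p, q, r]) (by
        rw [quad_three hR.symm]
        exact h)
      exact ⟨congrFun h1 0, congrFun h1 1, congrFun h1 2⟩) m3 m4 hz0 hz1 hz2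
      (hwx 0) (hwx 1) (hwx 2) hqw
    have hall : ∀ i, w i ^ 2 = x i ^ 2 := fun i => by fin_cases i <;> assumption
    ext i
    rw [Pi.pow_apply, Pi.pow_apply, Pi.smul_apply, smul_eq_mul, mul_pow, ← hall, hw2, inv_pow,
      inv_mul_cancel_left₀ (pow_pos hspos 2).ne']

end Three

end LinearMTL

theorem theorem3p8 (n p k : ℕ) (hk : 2 ≤ k)
    (X : Matrix (Fin n) (Fin p) ℝ) (Y : Matrix (Fin n) (Fin k) ℝ)
    (hY : LinearIndependent ℝ (LinearMTL.optPred X Y).transpose) :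
    -- q = 1
    (IsPathConnected (LinearMTL.paretoFront (LinearMTL.optPred X Y) 1) →
      LinearMTL.NonDegenerate (LinearMTL.paretoFront (LinearMTL.optPred X Y) 1)
        (LinearMTL.surfE (LinearMTL.optPred X Y)) →
      LinearMTL.NecessaryForExploration X Y 1 (LinearMTL.surfE (LinearMTL.optPred X Y))
        (LinearMTL.formE (LinearMTL.optPred X Y)) (LinearMTL.C1 (LinearMTL.optPred X Y))) ∧
    -- q = k - 1
    (IsPathConnected (LinearMTL.paretoFront (LinearMTL.optPred X Y) (k - 1)) →
      LinearMTL.NonDegenerate (LinearMTL.paretoFront (LinearMTL.optPred X Y) (k - 1))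
        (LinearMTL.surfI (LinearMTL.optPred X Y)) →
      LinearMTL.NecessaryForExploration X Y (k - 1) (LinearMTL.surfI (LinearMTL.optPred X Y))
        (LinearMTL.formI (LinearMTL.optPred X Y)) (LinearMTL.C2 (LinearMTL.optPred X Y))) ∧
    -- k = 3: no assumption on the Pareto front
    (k = 3 →
      LinearMTL.NecessaryForExploration X Y 1 (LinearMTL.surfE (LinearMTL.optPred X Y))
        (LinearMTL.formE (LinearMTL.optPred X Y)) (LinearMTL.C1 (LinearMTL.optPred X Y)) ∧
      LinearMTL.NecessaryForExploration X Y 2 (LinearMTL.surfI (LinearMTL.optPred X Y))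
        (LinearMTL.formI (LinearMTL.optPred X Y)) (LinearMTL.C2 (LinearMTL.optPred X Y))) := by
  have hinj := LinearMTL.mulVec_injective_of_linearIndependent hY
  have hk1 : 1 ≤ k := by omega
  refine ⟨fun hc hnd => ?_, fun _ _ => LinearMTL.necessaryForExploration_C2 hk1 hinj, ?_⟩
  · refine LinearMTL.necessaryForExploration_C1_of rfl hk1 hinj fun hC => ?_
    obtain ⟨T, T', v, hint, hev⟩ := hnd (LinearMTL.exists_intersectionPoint hinj hc hC)
    exact ⟨T, T', LinearMTL.exists_positive_of_relInterior hinj hint hev⟩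
  · rintro rfl
    exact ⟨LinearMTL.necessaryForExploration_C1_of rfl hk1 hinj
      (LinearMTL.exists_positive_three hinj), LinearMTL.necessaryForExploration_C2 hk1 hinj⟩
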